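/- Fix $k\ge 2$. A ($k$-dimensional, square) $k$-d grid of size $n\ge 1$ has $k-1$ input arrays $I_1,\dots,I_{k-1}$ and one output array $O$, each $(k-1)$-dimensional of size $n\times\cdots\times n$, a unit-cost function $g$ and an associative unit-cost operation $\oplus$. Each cell $x\in\{0,\dots,n-1\}^k$ has the value $g\bigl(x,(I_1)_{x^{(1)}},\dots,(I_{k-1})_{x^{(k-1)}}\bigr)$, where $x^{(j)}$ is $x$ with its $j$-th coordinate removed; computing the grid means to store in $O_y$ the $\oplus$-sum, in increasing order of the last coordinate, of the values of the $n$ cells $x$ with $x^{(k)}=y$. Let $\omega\ge 1$ be the cost of a write relative to a read. The parallel algorithm Asym-Alg is the following nested-parallel (fork-join) program. On a subgrid of size $n_1\times\cdots\times n_k$ with a given output array: if it is a single cell, store the value of the cell in its output entry. Otherwise choose, among the dimensions with $n_i\ge 2$, one that maximizes $n_ix_i$, where $x_k=\omega^{-(k-1)/k}$ and $x_j=1$ for $j<k$ (the first one in case of ties), halve it (sizes $\lfloor n_i/2\rfloor$ and $\lceil n_i/2\rceil$) and recurse on the two halves in parallel. If $i<k$, the halves write to disjoint parts of the output array. If $i=k$,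 two temporary arrays of the size of the output are allocated on the stack (in constant time), the halves write to these, and afterwards the output entries are set to the $\oplus$-sums of the corresponding temporary entries by a parallel loop (binary forking); the temporary arrays are then deallocated. The program is started on the whole grid. All arrays are stored in row-major order, the last index being contiguous. The work and the span are the number of operations and the length of a longest path of the computation DAG. The asymmetric cache complexity $Q$ is the minimum, over all (offline) replacement policies, of the number of cache-line reads from main memory plus $\omega$ times the number of cache-line writes to main memory in the sequential depth-first execution, with an initially empty cache of $M$ words and lines of $B\ge1$ words, where all entries used by an operation must be in the cache when it is executed and all modified lines must finally be written back. **Theorem.** For every $k\ge2$ there are constants $c,C,\tau>0$, depending only on $k$, such that for all $n\ge 1$ and all real $\omega\ge 1$ (and all $g$ and associative $\oplus$), the parallel version of Asym-Alg computes the $k$-d grid of size $n$, both in its sequential execution and under every parallel schedule, and 1. its work $W$ satisfies $c\,n^k\le W\le C\,n^k$; 2. its span is at most $C\log^2 n$ if $n\ge2$; 3. for all integers $M$ and $B\ge1$ with $M\ge\tau B^{k-1}$, $M\ge\tau\log\omega$ and $n\ge\omega^{(k-1)/k}M^{1/(k-1)}$, $$c\,\frac{n^k\omega^{1/k}}{M^{1/(k-1)}B}\;\le\;Q\;\le\;C\,\frac{n^k\omega^{1/k}}{M^{1/(k-1)}B}.$$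 -/

import Mathlib

open scoped ENNReal

namespace KDGrid

/-! ### Nested-parallel programs -/

/-- One unit-cost instruction on a word-addressed memory: read the words at the addresses `src`,
apply `f` to them and store the result at the address `dst`. -/
structure Instr (V : Type*) where
  arity : ℕ
  src : Fin arity → ℕ
  dst : ℕ
  f : (Fin arity → V) → V

/-- Programs of the nested-parallel model. `fork p q` runs `p` and `q` in parallel and joins them.
`alloc s body` allocates `s` consecutive words on the stack, runs `body a`, where `a` is the
address of the first of them, and deallocates them afterwards. -/
inductive Prog (V : Type*) where
  | skip : Prog V
  | instr (i : Instr V) : Prog V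
  | seq (p q : Prog V) : Prog V
  | fork (p q : Prog V) : Prog V
  | alloc (size : ℕ) (body : ℕ → Prog V) : Prog V

/-- The effect of an instruction on the memory. -/
def Instr.exec {V : Type*} (i : Instr V) (mem : ℕ → V) : ℕ → V :=
  Function.update mem i.dst (i.f fun t => mem (i.src t))

/-- The memory after the instructions of a list have been executed in order. -/
def run {V : Type*} (l : List (Instr V)) (mem : ℕ → V) : ℕ → V :=
  l.foldl (fun m i => i.exec m) mem

/-- `Shuffle l₁ l₂ l`: the list `l` is an interleaving of `l₁` and `l₂`. -/
inductive Shuffle {α : Type*} : List α → List α → List α → Prop where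
  | nil : Shuffle [] [] []
  | left {l₁ l₂ l : List α} (a : α) : Shuffle l₁ l₂ l → Shuffle (a :: l₁) l₂ (a :: l)
  | right {l₁ l₂ l : List α} (a : α) : Shuffle l₁ l₂ l → Shuffle l₁ (a :: l₂) (a :: l)

namespace Prog

variable {V : Type*}

/-- Work: the number of operations in the computation DAG (a fork with its join, and an
allocation, are unit-cost operations). In this and the next definitions the second argument is the
stack pointer, that is, the first free address. -/
def work : Prog V → ℕ → ℕ
  | skip, _ => 0
  | instr _, _ => 1
  | seq p q, sp => p.work sp + q.work sp
  | fork p q, sp => p.work sp + q.work sp + 1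
  | alloc s body, sp => (body sp).work (sp + s) + 1

/-- Span (depth): the length of a longest path in the computation DAG. -/
def span : Prog V → ℕ → ℕ
  | skip, _ => 0
  | instr _, _ => 1
  | seq p q, sp => p.span sp + q.span sp
  | fork p q, sp => max (p.span sp) (q.span sp) + 1
  | alloc s body, sp => (body sp).span (sp + s) + 1

/-- The instructions of the sequential (depth-first, left-to-right) execution. The two branches of
a fork run one after the other, so that the second one reuses the stack space that the first one
has released. -/
def trace : Prog V → ℕ → List (Instr V)
  | skip, _ => []
  | instr i, _ => [i]
  | seq p q, sp => p.trace sp ++ q.trace sp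
  | fork p q, sp => p.trace sp ++ q.trace sp
  | alloc s body, sp => (body sp).trace (sp + s)

/-- The number of stack words of a parallel execution in which the two branches of every fork get
disjoint parts of the stack. -/
def parSpace : Prog V → ℕ → ℕ
  | skip, _ => 0
  | instr _, _ => 0
  | seq p q, sp => max (p.parSpace sp) (q.parSpace sp)
  | fork p q, sp => p.parSpace sp + q.parSpace (sp + p.parSpace sp)
  | alloc s body, sp => s + (body sp).parSpace (sp + s)

/-- `p.IsSchedule sp l`: the list `l` is an order in which a parallel execution of `p` may execute
its instructions. The branches of a fork are interleaved arbitrarily; they use disjoint parts of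
the stack. -/
def IsSchedule : Prog V → ℕ → List (Instr V) → Prop
  | skip, _, l => l = []
  | instr i, _, l => l = [i]
  | seq p q, sp, l => ∃ l₁ l₂, p.IsSchedule sp l₁ ∧ q.IsSchedule sp l₂ ∧ l = l₁ ++ l₂
  | fork p q, sp, l => ∃ l₁ l₂, p.IsSchedule sp l₁ ∧ q.IsSchedule (sp + p.parSpace sp) l₂ ∧
      Shuffle l₁ l₂ l
  | alloc s body, sp, l => (body sp).IsSchedule (sp + s) l

/-- Parallel loop: `body t` for `lo ≤ t < lo + len`, by recursive binary forking. -/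
def parFor (body : ℕ → Prog V) (lo len : ℕ) : Prog V :=
  if len = 0 then skip
  else if len = 1 then body lo
  else fork (parFor body lo (len / 2)) (parFor body (lo + len / 2) (len - len / 2))
termination_by len
decreasing_by all_goals omega

end Prog

/-! ### The asymmetric ideal-cache model -/

/-- The lines (blocks of `B` consecutive words) that an instruction touches. -/
def Instr.lines {V : Type*} (B : ℕ) (i : Instr V) : Finset ℕ :=
  insert (i.dst / B) (Finset.univ.image fun t => i.src t / B)

/-- `CacheRun M B C D l r w`: with the set `C` of lines in the cache, those in `D ⊆ C` being dirty
(modified, not yet written back), the instruction list `l` can be executed on a cache of `M` words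
with lines of `B` words, by `r` line transfers from the main memory to the cache (reads) and `w`
line transfers from the cache to the main memory (writes). All lines that an instruction touches
have to be in the cache when it is executed, only clean lines may be dropped, and no dirty line may
be left at the end. The choice of the transfers is free, and may depend on the future. -/
inductive CacheRun {V : Type*} (M B : ℕ) :
    Finset ℕ → Finset ℕ → List (Instr V) → ℕ → ℕ → Prop where
  | done (C : Finset ℕ) : CacheRun M B C ∅ [] 0 0
  | load {C D : Finset ℕ} {l : List (Instr V)} {r w : ℕ} (x : ℕ) (hx : x ∉ C)
      (hroom : (C.card + 1) * B ≤ M) (h : CacheRun M B (insert x C) D l r w) :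
      CacheRun M B C D l (r + 1) w
  | drop {C D : Finset ℕ} {l : List (Instr V)} {r w : ℕ} (x : ℕ) (hx : x ∈ C) (hD : x ∉ D)
      (h : CacheRun M B (C.erase x) D l r w) : CacheRun M B C D l r w
  | writeBack {C D : Finset ℕ} {l : List (Instr V)} {r w : ℕ} (x : ℕ) (hx : x ∈ D)
      (h : CacheRun M B C (D.erase x) l r w) : CacheRun M B C D l r (w + 1)
  | step {C D : Finset ℕ} {l : List (Instr V)} {r w : ℕ} (i : Instr V) (hi : i.lines B ⊆ C)
      (h : CacheRun M B C (insert (i.dst / B) D) l r w) : CacheRun M B C D (i :: l) r w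

/-- Asymmetric cache complexity of an instruction sequence: the least possible value of
(number of reads) + `ω` * (number of writes), starting with an empty cache. It is `⊤` if the
sequence cannot be executed because the cache is too small. -/
noncomputable def asymCacheComplexity {V : Type*} (M B : ℕ) (ω : ℝ) (l : List (Instr V)) : ℝ≥0∞ :=
  ⨅ (r : ℕ) (w : ℕ) (_ : CacheRun M B ∅ ∅ l r w), ENNReal.ofReal ((r : ℝ) + ω * (w : ℝ))

/-! ### The `k`-d grid, with `k = d + 1`

Cells are `x : Fin (d + 1) → ℕ` with all coordinates below `n` (counted from `0`); the output
dimension, that is the last one, is `Fin.last d`. There are `d` input arrays; the `j`-th one is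
indexed by the cell coordinates other than the `j`-th, and the output array by those other than the
last. -/

/-- `f 0 ⊕ f 1 ⊕ ⋯ ⊕ f m`. -/
def orderedSum {V : Type*} (op : V → V → V) (f : ℕ → V) : ℕ → V
  | 0 => f 0
  | m + 1 => op (orderedSum op f m) (f (m + 1))

/-- The value of cell `x`: the function `g` of the cell, applied to its `d` input entries. -/
def cellValue {V : Type*} {d : ℕ} (g : (Fin (d + 1) → ℕ) → (Fin d → V) → V)
    (I : Fin d → (Fin d → ℕ) → V) (x : Fin (d + 1) → ℕ) : V :=
  g x fun j => I j (j.castSucc.removeNth x)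

/-- The entry `y` of the output array of the square grid of size `n ≥ 1` with input arrays `I`:
the sum of the values of the cells that project to `y`. -/
def gridOutput {V : Type*} {d : ℕ} (op : V → V → V) (g : (Fin (d + 1) → ℕ) → (Fin d → V) → V)
    (I : Fin d → (Fin d → ℕ) → V) (n : ℕ) (y : Fin d → ℕ) : V :=
  orderedSum op (fun t => cellValue g I (Fin.snoc (α := fun _ => ℕ) y t)) (n - 1)

/-! ### Arrays in memory -/

/-- Row-major position of the index `y` in an array of shape `s` (last index fastest). -/
def rowMajor {d : ℕ} (s y : Fin d → ℕ) : ℕ :=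
  ∑ i, y i * ∏ l ∈ Finset.Ioi i, s l

/-- The index at position `t` of the row-major order of an array of shape `s`. -/
def rowMajorIndex {d : ℕ} (s : Fin d → ℕ) (t : ℕ) : Fin d → ℕ :=
  fun i => (t / ∏ l ∈ Finset.Ioi i, s l) % s i

/-- Address of the entry `y` of the `j`-th input array; the input arrays, the output array and the
stack follow each other in memory. -/
def inputAddr {d : ℕ} (n : ℕ) (j : Fin d) (y : Fin d → ℕ) : ℕ :=
  (j : ℕ) * n ^ d + rowMajor (fun _ => n) y

/-- Address of the entry `y` of the output array. -/
def outputAddr {d : ℕ} (n : ℕ) (y : Fin d → ℕ) : ℕ :=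
  d * n ^ d + rowMajor (fun _ => n) y

/-- First address of the stack. -/
def stackBase (d n : ℕ) : ℕ := (d + 1) * n ^ d

/-! ### The algorithm -/

/-- The weights `x_i`: `ω ^ (-(k-1)/k)` for the last dimension and `1` for the others. -/
noncomputable def dimWeight {d : ℕ} (ω : ℝ) (i : Fin (d + 1)) : ℝ :=
  if i = Fin.last d then ω ^ (-((d : ℝ) / ((d : ℝ) + 1))) else 1

/-- The dimension to partition for a subproblem of size `len 0 × ⋯ × len d`: among those that can
be partitioned, the (first) one that maximizes `len i * x_i`; `none` for a single cell. -/
noncomputable def pickDim {d : ℕ} (ω : ℝ) (len : Fin (d + 1) → ℕ) : Option (Fin (d + 1)) :=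
  ((List.finRange (d + 1)).filter fun i => 2 ≤ len i).argmax
    fun i => (len i : ℝ) * dimWeight ω i

theorem two_le_of_pickDim {d : ℕ} {ω : ℝ} {len : Fin (d + 1) → ℕ} {i : Fin (d + 1)}
    (h : pickDim ω len = some i) : 2 ≤ len i := by
  have := List.argmax_mem (Option.mem_def.2 h)
  simpa using this

theorem sum_update_lt {d : ℕ} (len : Fin d → ℕ) (i : Fin d) {a : ℕ} (h : a < len i) :
    ∑ j, Function.update len i a j < ∑ j, len j := by
  refine Finset.sum_lt_sum (fun j _ => ?_) ⟨i, Finset.mem_univ i, by simpa using h⟩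
  by_cases hj : j = i
  · subst hj; simpa using h.le
  · simp [hj]

/-- The parallel algorithm on the cells `x` with `lo i ≤ x i < lo i + len i`, where `inp j y` is
the address of the entry `y` of the `j`-th input array and `out y` that of the entry `y` of the
array that receives the output. The picked dimension is halved. If it is the last one, the two
subproblems share their output entries; they run in parallel on two temporary arrays of the size
of the output, whose entries are then added in parallel. Otherwise the subproblems have disjoint
outputs and run in parallel. -/
noncomputable def asymAlg {V : Type*} {d : ℕ} (ω : ℝ) (op : V → V → V)
    (g : (Fin (d + 1) → ℕ) → (Fin d → V) → V) (inp : Fin d → (Fin d → ℕ) → ℕ)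
    (lo len : Fin (d + 1) → ℕ) (out : (Fin d → ℕ) → ℕ) : Prog V :=
  match _h : pickDim ω len with
  | none =>
      .instr ⟨d, fun j => inp j (j.castSucc.removeNth lo), out ((Fin.last d).removeNth lo), g lo⟩
  | some i =>
      if i = Fin.last d then
        .alloc (∏ j : Fin d, len j.castSucc) fun ta =>
          .alloc (∏ j : Fin d, len j.castSucc) fun tb =>
            .seq
              (.fork
                (asymAlg ω op g inp lo (Function.update len i (len i / 2))
                  (fun y => ta + rowMajor (fun j => len j.castSucc)
                    (fun j => y j - lo j.castSucc)))
                (asymAlg ω op g inp (Function.update lo i (lo i + len i / 2))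
                  (Function.update len i (len i - len i / 2))
                  (fun y => tb + rowMajor (fun j => len j.castSucc)
                    (fun j => y j - lo j.castSucc))))
              (.parFor
                (fun t => .instr ⟨2, ![ta + t, tb + t],
                  out (fun j => lo j.castSucc + rowMajorIndex (fun j => len j.castSucc) t j),
                  fun v => op (v 0) (v 1)⟩)
                0 (∏ j : Fin d, len j.castSucc))
      else
        .fork
          (asymAlg ω op g inp lo (Function.update len i (len i / 2)) out)
          (asymAlg ω op g inp (Function.update lo i (lo i + len i / 2))
            (Function.update len i (len i - len i / 2)) out)
termination_by ∑ j, len j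
decreasing_by
  all_goals
    have := two_le_of_pickDim _h
    exact sum_update_lt len i (by omega)

/-- The parallel algorithm on the whole square grid of size `n`. -/
noncomputable def gridProg {V : Type*} {d : ℕ} (ω : ℝ) (op : V → V → V)
    (g : (Fin (d + 1) → ℕ) → (Fin d → V) → V) (n : ℕ) : Prog V :=
  asymAlg ω op g (inputAddr n) (fun _ => 0) (fun _ => n) (outputAddr n)

/-- Executing the instruction list `l` computes the grid: from any initial memory, the output array
ends up with the entries of the grid on the input arrays that the initial memory contains. -/
def Computes {V : Type*} {d : ℕ} (op : V → V → V) (g : (Fin (d + 1) → ℕ) → (Fin d → V) → V)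
    (n : ℕ) (l : List (Instr V)) : Prop :=
  ∀ (mem : ℕ → V) (y : Fin d → ℕ), (∀ j, y j < n) →
    run l mem (outputAddr n y) = gridOutput op g (fun j z => mem (inputAddr n j z)) n y

/-- `n^k ω^{1/k} / (M^{1/(k-1)} B)` for `k = d + 1`. -/
noncomputable def cacheBound (d n : ℕ) (ω : ℝ) (M B : ℕ) : ℝ :=
  (n : ℝ) ^ (d + 1) * ω ^ (1 / ((d : ℝ) + 1)) / ((M : ℝ) ^ (1 / (d : ℝ)) * (B : ℝ))

end KDGrid

/-! Put d = k - 1, p = ω^(1/k) and q = p^d. The last dimension has weight 1/q, and ω/q = p.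

Correctness, work and span are inductions along the recursion (`box_induction`). For correctness,
`Good` records where an execution of a box reads and writes, and what it computes if inputs, outputs
and stack do not overlap. It is preserved by both kinds of split (`good_other`, `good_last`),
whether the branches run one after the other on shared stack space or interleaved on disjoint stack
space.

Lower bound (`needsWrites_trace`): only writes are counted. With s = M^(1/d), follow the recursion
down to boxes whose last extent is at most 5sq. The selection rule keeps their other extents at
least 2s, so such a box has at least 2M output entries. At most M/B of the lines it modifies can
still be dirty in the cache when it ends, so a positive fraction of area/B lines is written back.
This is proportional to the volume divided by sqB. Summing over the boxes gives n^k/(10sqB) writes,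
each of cost ω.

Upper bound (`freshCost_trace`): an explicit replacement policy with two scales. Now s is a small
constant times M^(1/d). A box of extents about s, ..., s, sq keeps its output and its whole stack in
the cache, which costs O(ω s^d/B) per box, hence O(p n^k/(sB)) altogether. The stack fits because
its size is a geometric sum plus a logarithmic term (`seqSpace_le`); the latter is the reason for M
≥ τ log ω. Inside such a box, the recursion passes through boxes of extents about σ, ..., σ, μ with
σ = max(1, s/p) and σ^(d-1) μ = s^d, whose input faces fit in the cache beside the pinned lines
(`pinnedReads_trace`). The reads per cell are O(1/(σB)), which is O(p/(sB)). The additions above the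
outer scale are paid for by a potential proportional to the output area, which doubles in a split of
the last dimension. That the recursion meets boxes of the prescribed shape, up to a factor 3, is the
content of `IsScale` and `IsLarge.halves`. -/

namespace KDGrid

/-! ### The recursion -/

section recursion

variable {V : Type*} {d : ℕ}

theorem lt_two_of_pickDim_none {ω : ℝ} {len : Fin (d + 1) → ℕ} (h : pickDim ω len = none)
    (i : Fin (d + 1)) : len i < 2 := by
  unfold pickDim at h
  rw [List.argmax_eq_none] at h
  by_contra hi
  have : i ∈ (List.finRange (d + 1)).filter fun i => 2 ≤ len i := by
    simp only [List.mem_filter, List.mem_finRange, true_and, decide_eq_true_eq]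
    omega
  rw [h] at this
  simp at this

theorem le_of_pickDim {ω : ℝ} {len : Fin (d + 1) → ℕ} {i : Fin (d + 1)}
    (h : pickDim ω len = some i) {j : Fin (d + 1)} (hj : 2 ≤ len j) :
    (len j : ℝ) * dimWeight ω j ≤ (len i : ℝ) * dimWeight ω i := by
  unfold pickDim at h
  refine List.le_of_mem_argmax (f := fun i => (len i : ℝ) * dimWeight ω i) ?_ (Option.mem_def.2 h)
  simpa using hj

/-- The number of output entries of a box. -/
def area (len : Fin (d + 1) → ℕ) : ℕ := ∏ j : Fin d, len j.castSucc

/-- The number of cells of a box. -/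
def vol (len : Fin (d + 1) → ℕ) : ℕ := ∏ j, len j

theorem vol_eq (len : Fin (d + 1) → ℕ) : vol len = area len * len (Fin.last d) :=
  Fin.prod_univ_castSucc _

/-- The address of an output entry in a temporary array that starts at `ta`. -/
def tempAddr (ta : ℕ) (lo len : Fin (d + 1) → ℕ) : (Fin d → ℕ) → ℕ := fun y =>
  ta + rowMajor (fun j => len j.castSucc) (fun j => y j - lo j.castSucc)

/-- The output entry at position `t` of a box. -/
def outIndex (lo len : Fin (d + 1) → ℕ) (t : ℕ) : Fin d → ℕ := fun j =>
  lo j.castSucc + rowMajorIndex (fun j => len j.castSucc) t j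

/-- The instruction that adds the entries at position `t` of two temporary arrays. -/
def addInstr (op : V → V → V) (lo len : Fin (d + 1) → ℕ) (out : (Fin d → ℕ) → ℕ)
    (ta tb t : ℕ) : Instr V :=
  ⟨2, ![ta + t, tb + t], out (outIndex lo len t), fun v => op (v 0) (v 1)⟩

/-- The instruction that computes a cell. -/
def cellInstr (g : (Fin (d + 1) → ℕ) → (Fin d → V) → V) (inp : Fin d → (Fin d → ℕ) → ℕ)
    (lo : Fin (d + 1) → ℕ) (out : (Fin d → ℕ) → ℕ) : Instr V :=
  ⟨d, fun j => inp j (j.castSucc.removeNth lo), out ((Fin.last d).removeNth lo), g lo⟩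

/-- The extents of the first half of a box that is halved in dimension `i`. -/
def len₁ (len : Fin (d + 1) → ℕ) (i : Fin (d + 1)) : Fin (d + 1) → ℕ :=
  Function.update len i (len i / 2)

/-- The extents of the second half of a box that is halved in dimension `i`. -/
def len₂ (len : Fin (d + 1) → ℕ) (i : Fin (d + 1)) : Fin (d + 1) → ℕ :=
  Function.update len i (len i - len i / 2)

/-- The corner of the second half of a box that is halved in dimension `i`. -/
def lo₂ (lo len : Fin (d + 1) → ℕ) (i : Fin (d + 1)) : Fin (d + 1) → ℕ :=
  Function.update lo i (lo i + len i / 2)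

variable (ω : ℝ) (op : V → V → V) (g : (Fin (d + 1) → ℕ) → (Fin d → V) → V)
  (inp : Fin d → (Fin d → ℕ) → ℕ) (lo : Fin (d + 1) → ℕ) {len : Fin (d + 1) → ℕ}
  (out : (Fin d → ℕ) → ℕ)

theorem asymAlg_none (h : pickDim ω len = none) :
    asymAlg ω op g inp lo len out = .instr (cellInstr g inp lo out) := by
  rw [asymAlg]
  split
  · rfl
  · simp_all

theorem asymAlg_last (h : pickDim ω len = some (Fin.last d)) :
    asymAlg ω op g inp lo len out =
      .alloc (area len) fun ta => .alloc (area len) fun tb =>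
        .seq
          (.fork
            (asymAlg ω op g inp lo (len₁ len (Fin.last d)) (tempAddr ta lo len))
            (asymAlg ω op g inp (lo₂ lo len (Fin.last d)) (len₂ len (Fin.last d))
              (tempAddr tb lo len)))
          (.parFor (fun t => .instr (addInstr op lo len out ta tb t)) 0 (area len)) := by
  rw [asymAlg]
  split
  · simp_all
  · rename_i i hi
    obtain rfl : i = Fin.last d := by simpa [h] using hi.symm
    simp only [if_true]
    rfl

theorem asymAlg_other {i : Fin (d + 1)} (h : pickDim ω len = some i) (hi : i ≠ Fin.last d) :
    asymAlg ω op g inp lo len out =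
      .fork (asymAlg ω op g inp lo (len₁ len i) out)
        (asymAlg ω op g inp (lo₂ lo len i) (len₂ len i) out) := by
  rw [asymAlg]
  split
  · simp_all
  · rename_i j hj
    obtain rfl : j = i := by simpa [h] using hj.symm
    rw [if_neg hi]
    rfl

end recursion

/-! ### Extents, volumes and areas of the halves of a box -/

section halves

variable {d : ℕ} {lo len : Fin (d + 1) → ℕ} {i : Fin (d + 1)}

theorem one_le_len₁ (hl : ∀ j, 1 ≤ len j) (hi : 2 ≤ len i) (j) : 1 ≤ len₁ len i j := by
  unfold len₁
  by_cases h : j = i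
  · subst h; simp; omega
  · simp [h, hl]

theorem one_le_len₂ (hl : ∀ j, 1 ≤ len j) (hi : 2 ≤ len i) (j) : 1 ≤ len₂ len i j := by
  unfold len₂
  by_cases h : j = i
  · subst h; simp; omega
  · simp [h, hl]

@[simp] theorem len₁_self : len₁ len i i = len i / 2 := by simp [len₁]
@[simp] theorem len₂_self : len₂ len i i = len i - len i / 2 := by simp [len₂]
@[simp] theorem lo₂_self : lo₂ lo len i i = lo i + len i / 2 := by simp [lo₂]
theorem len₁_ne {j : Fin (d + 1)} (h : j ≠ i) : len₁ len i j = len j := by simp [len₁, h]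
theorem len₂_ne {j : Fin (d + 1)} (h : j ≠ i) : len₂ len i j = len j := by simp [len₂, h]
theorem lo₂_ne {j : Fin (d + 1)} (h : j ≠ i) : lo₂ lo len i j = lo j := by simp [lo₂, h]

@[simp] theorem len₁_last_castSucc (j : Fin d) :
    len₁ len (Fin.last d) j.castSucc = len j.castSucc := len₁_ne (Fin.castSucc_lt_last j).ne
@[simp] theorem len₂_last_castSucc (j : Fin d) :
    len₂ len (Fin.last d) j.castSucc = len j.castSucc := len₂_ne (Fin.castSucc_lt_last j).ne
@[simp] theorem lo₂_last_castSucc (j : Fin d) :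
    lo₂ lo len (Fin.last d) j.castSucc = lo j.castSucc := lo₂_ne (Fin.castSucc_lt_last j).ne

theorem len₁_le (j) : len₁ len i j ≤ len j := by
  by_cases h : j = i
  · subst h; simp; omega
  · rw [len₁_ne h]

theorem len₂_le (j) : len₂ len i j ≤ len j := by
  by_cases h : j = i
  · subst h; simp
  · rw [len₂_ne h]

theorem prod_update_add {ι : Type*} [Fintype ι] [DecidableEq ι] (f : ι → ℕ) (i : ι) {a b : ℕ}
    (h : a + b = f i) :
    ∏ j, Function.update f i a j + ∏ j, Function.update f i b j = ∏ j, f j := by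
  rw [Finset.prod_update_of_mem (Finset.mem_univ i), Finset.prod_update_of_mem (Finset.mem_univ i),
    ← add_mul, h]
  exact (Finset.prod_eq_mul_prod_sdiff_singleton_of_mem (Finset.mem_univ i) f).symm

theorem vol_halves (len : Fin (d + 1) → ℕ) (i : Fin (d + 1)) :
    vol (len₁ len i) + vol (len₂ len i) = vol len :=
  prod_update_add _ _ (by omega)

theorem area_len₁_last : area (len₁ len (Fin.last d)) = area len := by
  simp [area]

theorem area_len₂_last : area (len₂ len (Fin.last d)) = area len := by
  simp [area]

theorem area_halves (hi : i ≠ Fin.last d) :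
    area (len₁ len i) + area (len₂ len i) = area len := by
  obtain ⟨j, rfl⟩ := Fin.exists_castSucc_eq.2 hi
  have key : ∀ a, (fun l : Fin d => Function.update len j.castSucc a l.castSucc)
      = Function.update (fun l : Fin d => len l.castSucc) j a := by
    intro a
    ext l
    by_cases h : l = j
    · subst h; simp
    · rw [Function.update_of_ne h, Function.update_of_ne (by simpa using h)]
  have h1 : area (len₁ len j.castSucc)
      = ∏ l, Function.update (fun l : Fin d => len l.castSucc) j (len j.castSucc / 2) l := by
    rw [← key]; rfl
  have h2 : area (len₂ len j.castSucc) = ∏ l, Function.update (fun l : Fin d => len l.castSucc) j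
      (len j.castSucc - len j.castSucc / 2) l := by
    rw [← key]; rfl
  rw [h1, h2]
  exact prod_update_add _ _ (by omega)

theorem one_le_area (hl : ∀ j, 1 ≤ len j) : 1 ≤ area len :=
  Nat.one_le_iff_ne_zero.2 (Finset.prod_ne_zero_iff.2 fun j _ => by have := hl j.castSucc; omega)

/-- Induction along the recursion of the algorithm. -/
theorem box_induction (ω : ℝ) {motive : (Fin (d + 1) → ℕ) → (Fin (d + 1) → ℕ) → Prop}
    (cell : ∀ lo len, (∀ j, len j = 1) → pickDim ω len = none → motive lo len)
    (split : ∀ lo len i, (∀ j, 1 ≤ len j) → 2 ≤ len i → pickDim ω len = some i →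
      motive lo (len₁ len i) → motive (lo₂ lo len i) (len₂ len i) → motive lo len)
    (lo len : Fin (d + 1) → ℕ) (hl : ∀ j, 1 ≤ len j) : motive lo len := by
  induction hN : ∑ j, len j using Nat.strong_induction_on generalizing lo len with
  | _ N ih =>
    subst hN
    rcases h : pickDim ω len with _ | i
    · exact cell lo len (fun j => by have := lt_two_of_pickDim_none h j; have := hl j; omega) h
    · have hi := two_le_of_pickDim h
      exact split lo len i hl hi h
        (ih _ (sum_update_lt len i (by omega)) _ _ (one_le_len₁ hl hi) rfl)
        (ih _ (sum_update_lt len i (by omega)) _ _ (one_le_len₂ hl hi) rfl)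

end halves

/-! ### Work and span -/

section work

variable {V : Type*} {d : ℕ}

theorem Prog.parFor_induction {V : Type*} {motive : ℕ → ℕ → Prog V → Prop}
    (body : ℕ → Prog V) (zero : ∀ lo, motive lo 0 .skip) (one : ∀ lo, motive lo 1 (body lo))
    (step : ∀ lo a b p q, 1 ≤ a → a ≤ b → b ≤ a + 1 → motive lo a p → motive (lo + a) b q →
      motive lo (a + b) (.fork p q)) (lo len : ℕ) : motive lo len (.parFor body lo len) := by
  induction len using Nat.strong_induction_on generalizing lo with
  | _ len ih =>
    rw [Prog.parFor]
    split_ifs with h0 h1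
    · subst h0; exact zero lo
    · subst h1; exact one lo
    · have := step lo (len / 2) (len - len / 2) _ _ (by omega) (by omega) (by omega)
        (ih (len / 2) (by omega) lo) (ih (len - len / 2) (by omega) (lo + len / 2))
      rwa [show len / 2 + (len - len / 2) = len by omega] at this

theorem Prog.work_parFor_instr (F : ℕ → Instr V) (lo len sp : ℕ) :
    (Prog.parFor (fun t => .instr (F t)) lo len).work sp ≤ 2 * len := by
  -- A nonempty loop has one fork fewer than iterations; the induction needs this spare unit in each
  -- half to pay for the fork.
  have : (Prog.parFor (fun t => .instr (F t)) lo len).work sp + (if len = 0 then 0 else 1)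
      ≤ 2 * len := by
    refine Prog.parFor_induction
      (motive := fun _ len p => p.work sp + (if len = 0 then 0 else 1) ≤ 2 * len) _ ?_ ?_ ?_ lo len
    · intro lo; simp [Prog.work]
    · intro lo; simp [Prog.work]
    · intro lo a b p q ha hab _ hp hq
      rw [if_neg (by omega)] at hp hq ⊢
      simp only [Prog.work]
      omega
  omega

theorem Prog.span_parFor_instr (F : ℕ → Instr V) (lo len sp : ℕ) :
    (Prog.parFor (fun t => .instr (F t)) lo len).span sp ≤ Nat.clog 2 len + 1 := by
  refine Prog.parFor_induction
      (motive := fun _ len p => p.span sp ≤ Nat.clog 2 len + 1) _ ?_ ?_ ?_ lo len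
  · intro lo; simp [Prog.span]
  · intro lo; simp [Prog.span]
  · intro lo a b p q ha hab hba hp hq
    rw [Nat.clog_of_one_lt (by norm_num) (by omega : 1 < a + b),
      show (a + b + 2 - 1) / 2 = b by omega]
    have := Nat.clog_mono_right 2 hab
    simp only [Prog.span]
    omega

variable (ω : ℝ) (op : V → V → V) (g : (Fin (d + 1) → ℕ) → (Fin d → V) → V)
  (inp : Fin d → (Fin d → ℕ) → ℕ)

/-- The area is a potential. A split of the last dimension gives both halves the full area, so a
surplus of 4 * area is released, which covers the additions and their forks. In any other split the
areas add up, and the extra 1 pays for the fork. -/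
theorem work_asymAlg_le (lo len : Fin (d + 1) → ℕ) (hl : ∀ j, 1 ≤ len j)
    (out : (Fin d → ℕ) → ℕ) (sp : ℕ) :
    (asymAlg ω op g inp lo len out).work sp + 4 * area len + 1 ≤ 6 * vol len := by
  revert out sp
  refine box_induction ω (motive := fun lo len => ∀ out sp,
    (asymAlg ω op g inp lo len out).work sp + 4 * area len + 1 ≤ 6 * vol len) ?_ ?_ lo len hl
  · intro lo len h1 h out sp
    rw [asymAlg_none _ _ _ _ _ _ h]
    simp [Prog.work, area, vol, h1]
  · intro lo len i hl hi h ih1 ih2 out sp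
    have hv := vol_halves len i
    by_cases hil : i = Fin.last d
    · subst hil
      rw [asymAlg_last _ _ _ _ _ _ h]
      simp only [Prog.work]
      have h1 := ih1 (tempAddr sp lo len) (sp + area len + area len)
      have h2 := ih2 (tempAddr (sp + area len) lo len) (sp + area len + area len)
      rw [area_len₁_last] at h1
      rw [area_len₂_last] at h2
      have h3 := Prog.work_parFor_instr (addInstr op lo len out sp (sp + area len)) 0 (area len)
        (sp + area len + area len)
      have := one_le_area hl
      omega
    · rw [asymAlg_other _ _ _ _ _ _ h hil]
      simp only [Prog.work]
      have h1 := ih1 out sp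
      have h2 := ih2 out sp
      have := area_halves (len := len) hil
      omega

theorem vol_le_work_asymAlg (lo len : Fin (d + 1) → ℕ) (hl : ∀ j, 1 ≤ len j)
    (out : (Fin d → ℕ) → ℕ) (sp : ℕ) :
    vol len ≤ (asymAlg ω op g inp lo len out).work sp := by
  revert out sp
  refine box_induction ω (motive := fun lo len => ∀ out sp,
    vol len ≤ (asymAlg ω op g inp lo len out).work sp) ?_ ?_ lo len hl
  · intro lo len h1 h out sp
    rw [asymAlg_none _ _ _ _ _ _ h]
    simp [Prog.work, vol, h1]
  · intro lo len i hl hi h ih1 ih2 out sp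
    have hv := vol_halves len i
    by_cases hil : i = Fin.last d
    · subst hil
      rw [asymAlg_last _ _ _ _ _ _ h]
      simp only [Prog.work]
      have h1 := ih1 (tempAddr sp lo len) (sp + area len + area len)
      have h2 := ih2 (tempAddr (sp + area len) lo len) (sp + area len + area len)
      omega
    · rw [asymAlg_other _ _ _ _ _ _ h hil]
      simp only [Prog.work]
      have h1 := ih1 out sp
      have h2 := ih2 out sp
      omega

theorem clog_div_two_lt {m : ℕ} (h : 2 ≤ m) :
    Nat.clog 2 (m / 2) + 1 ≤ Nat.clog 2 m ∧ Nat.clog 2 (m - m / 2) + 1 = Nat.clog 2 m := by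
  rw [Nat.clog_of_one_lt (by norm_num) (by omega : 1 < m),
    show (m + 2 - 1) / 2 = m - m / 2 by omega]
  exact ⟨Nat.succ_le_succ (Nat.clog_mono_right 2 (by omega)), rfl⟩

/-- The sum of the rounded-up logarithms bounds the remaining recursion depth, since halving lowers
one summand and leaves the others unchanged. -/
theorem sum_clog_halves {len : Fin (d + 1) → ℕ} {i : Fin (d + 1)} (hi : 2 ≤ len i) :
    ∑ j, Nat.clog 2 (len₁ len i j) + 1 ≤ ∑ j, Nat.clog 2 (len j) ∧
    ∑ j, Nat.clog 2 (len₂ len i j) + 1 ≤ ∑ j, Nat.clog 2 (len j) := by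
  have key : ∀ f : Fin (d + 1) → ℕ, (∀ j, j ≠ i → f j = len j) →
      Nat.clog 2 (f i) + 1 ≤ Nat.clog 2 (len i) →
      ∑ j, Nat.clog 2 (f j) + 1 ≤ ∑ j, Nat.clog 2 (len j) := by
    intro f hf hfi
    rw [Nat.succ_le_iff]
    refine Finset.sum_lt_sum (fun j _ => ?_) ⟨i, Finset.mem_univ i, hfi⟩
    by_cases hj : j = i
    · subst hj; omega
    · rw [hf j hj]
  exact ⟨key _ (fun j hj => len₁_ne hj) (by simpa using (clog_div_two_lt hi).1),
    key _ (fun j hj => len₂_ne hj) (by simpa using (clog_div_two_lt hi).2.le)⟩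

theorem clog_area_le {len : Fin (d + 1) → ℕ} {n : ℕ} (h : ∀ j, len j ≤ n) :
    Nat.clog 2 (area len) ≤ d * Nat.clog 2 n := by
  refine Nat.clog_le_of_le_pow ?_
  calc area len ≤ ∏ _j : Fin d, n := Finset.prod_le_prod' fun j _ => h _
    _ = n ^ d := by simp
    _ ≤ (2 ^ Nat.clog 2 n) ^ d := Nat.pow_le_pow_left (Nat.le_pow_clog (by norm_num) n) d
    _ = 2 ^ (d * Nat.clog 2 n) := by rw [← pow_mul, mul_comm]

/-- One level of the recursion adds at most two allocations, a fork and a loop over at most n^d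
entries, whose depth is logarithmic. -/
theorem span_asymAlg_le (n : ℕ) (lo len : Fin (d + 1) → ℕ) (hl : ∀ j, 1 ≤ len j)
    (hn : ∀ j, len j ≤ n) (out : (Fin d → ℕ) → ℕ) (sp : ℕ) :
    (asymAlg ω op g inp lo len out).span sp
      ≤ 1 + (∑ j, Nat.clog 2 (len j)) * (d * Nat.clog 2 n + 4) := by
  revert hn out sp
  refine box_induction ω (motive := fun lo len => (∀ j, len j ≤ n) → ∀ out sp,
    (asymAlg ω op g inp lo len out).span sp
      ≤ 1 + (∑ j, Nat.clog 2 (len j)) * (d * Nat.clog 2 n + 4)) ?_ ?_ lo len hl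
  · intro lo len h1 h hn out sp
    rw [asymAlg_none _ _ _ _ _ _ h]
    simp [Prog.span]
  · intro lo len i hl hi h ih1 ih2 hn out sp
    have ih1 := ih1 fun j => (len₁_le j).trans (hn j)
    have ih2 := ih2 fun j => (len₂_le j).trans (hn j)
    obtain ⟨hc1, hc2⟩ := sum_clog_halves hi
    have e1 := Nat.mul_le_mul_right (d * Nat.clog 2 n + 4) hc1
    have e2 := Nat.mul_le_mul_right (d * Nat.clog 2 n + 4) hc2
    rw [add_mul] at e1 e2
    by_cases hil : i = Fin.last d
    · subst hil
      rw [asymAlg_last _ _ _ _ _ _ h]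
      simp only [Prog.span]
      have h1 := ih1 (tempAddr sp lo len) (sp + area len + area len)
      have h2 := ih2 (tempAddr (sp + area len) lo len) (sp + area len + area len)
      have h3 := Prog.span_parFor_instr (addInstr op lo len out sp (sp + area len)) 0 (area len)
        (sp + area len + area len)
      have h4 := clog_area_le hn
      omega
    · rw [asymAlg_other _ _ _ _ _ _ h hil]
      simp only [Prog.span]
      have h1 := ih1 out sp
      have h2 := ih2 out sp
      omega

theorem clog_le_three_mul_log {n : ℕ} (hn : 2 ≤ n) : (Nat.clog 2 n : ℝ) ≤ 3 * Real.log n := by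
  have h1 : 2 ^ (Nat.clog 2 n - 1) ≤ n := (Nat.pow_pred_clog_lt_self (by norm_num) hn).le
  have hc : 1 ≤ Nat.clog 2 n := Nat.clog_pos (by norm_num) hn
  have h2 : ((Nat.clog 2 n : ℝ) - 1) * Real.log 2 ≤ Real.log n := by
    have : ((2 : ℝ) ^ (Nat.clog 2 n - 1)) ≤ n := by exact_mod_cast h1
    have := Real.log_le_log (by positivity) this
    rwa [Real.log_pow, Nat.cast_sub hc, Nat.cast_one] at this
  have h3 : Real.log 2 ≤ Real.log n :=
    Real.log_le_log (by norm_num) (by exact_mod_cast hn)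
  have h4 := Real.log_two_gt_d9
  have h5 : (0 : ℝ) ≤ Nat.clog 2 n := Nat.cast_nonneg _
  nlinarith

theorem span_gridProg_le {n : ℕ} (hn : 2 ≤ n) (sp : ℕ) :
    ((gridProg ω op g n).span sp : ℝ)
      ≤ (3 + 3 * (d + 1) * (3 * d + 6)) * Real.log n ^ 2 := by
  have h := span_asymAlg_le ω op g (inputAddr n) n (fun _ => 0) (fun _ => n)
    (fun _ => by omega) (fun _ => le_rfl) (outputAddr n) sp
  simp only [Finset.sum_const, Finset.card_univ, Fintype.card_fin, smul_eq_mul] at h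
  have h' : ((gridProg ω op g n).span sp : ℝ)
      ≤ 1 + ((d + 1) * Nat.clog 2 n) * (d * Nat.clog 2 n + 4) := by
    have := (Nat.cast_le (α := ℝ)).2 h
    push_cast at this
    exact this
  refine h'.trans ?_
  have hc := clog_le_three_mul_log hn
  have hL : (0.69 : ℝ) ≤ Real.log n := by
    have h3 : Real.log 2 ≤ Real.log n :=
      Real.log_le_log (by norm_num) (by exact_mod_cast hn)
    have h4 := Real.log_two_gt_d9
    linarith
  set L := Real.log n
  have hc0 : (0 : ℝ) ≤ Nat.clog 2 n := Nat.cast_nonneg _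
  have hd0 : (0 : ℝ) ≤ d := Nat.cast_nonneg _
  -- The bound 0.69 ≤ L is just enough for 1 ≤ 3 * L ^ 2 and 4 ≤ 6 * L.
  calc 1 + ((d + 1 : ℝ) * Nat.clog 2 n) * (d * Nat.clog 2 n + 4)
      ≤ 3 * L ^ 2 + ((d + 1 : ℝ) * (3 * L)) * (d * (3 * L) + 6 * L) := by
        gcongr
        · nlinarith
        · nlinarith
    _ = _ := by ring

end work

/-! ### Boxes and the row-major order -/

section rowMajor

/-- The points `y` with `a i ≤ y i < a i + n i`. -/
def box {m : ℕ} (a n : Fin m → ℕ) : Finset (Fin m → ℕ) :=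
  Fintype.piFinset fun i => Finset.Ico (a i) (a i + n i)

theorem mem_box {m : ℕ} {a n y : Fin m → ℕ} :
    y ∈ box a n ↔ ∀ i, a i ≤ y i ∧ y i < a i + n i := by
  simp [box]

theorem rowMajor_succ {d : ℕ} (s y : Fin (d + 1) → ℕ) :
    rowMajor s y = y 0 * ∏ i, Fin.tail s i + rowMajor (Fin.tail s) (Fin.tail y) := by
  simp only [rowMajor, Fin.sum_univ_succ, Fin.prod_Ioi_zero, Fin.prod_Ioi_succ, Fin.tail]

theorem rowMajor_lt {d : ℕ} {s y : Fin d → ℕ} (h : ∀ i, y i < s i) :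
    rowMajor s y < ∏ i, s i := by
  induction d with
  | zero => simp [rowMajor]
  | succ d ih =>
    rw [rowMajor_succ, Fin.prod_univ_succ]
    have h1 := ih (s := Fin.tail s) (y := Fin.tail y) fun i => h i.succ
    have h2 : (y 0 + 1) * ∏ i, Fin.tail s i ≤ s 0 * ∏ i, Fin.tail s i :=
      Nat.mul_le_mul_right _ (h 0)
    rw [add_mul] at h2
    simp only [Fin.tail] at *
    omega

theorem rowMajor_injective {d : ℕ} {s y z : Fin d → ℕ} (hy : ∀ i, y i < s i)
    (hz : ∀ i, z i < s i) (h : rowMajor s y = rowMajor s z) : y = z := by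
  induction d with
  | zero => exact Subsingleton.elim _ _
  | succ d ih =>
    rw [rowMajor_succ, rowMajor_succ] at h
    have h1 := rowMajor_lt (s := Fin.tail s) (y := Fin.tail y) fun i => hy i.succ
    have h2 := rowMajor_lt (s := Fin.tail s) (y := Fin.tail z) fun i => hz i.succ
    have hP : 0 < ∏ i, Fin.tail s i := by omega
    have h0 : y 0 = z 0 := by
      have := congrArg (· / ∏ i, Fin.tail s i) h
      simpa [Nat.mul_comm _ (∏ i, Fin.tail s i), Nat.mul_add_div hP, Nat.div_eq_of_lt h1,
        Nat.div_eq_of_lt h2] using this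
    rw [h0] at h
    have ht : Fin.tail y = Fin.tail z := ih (s := Fin.tail s) (fun i => hy i.succ) (fun i => hz i.succ)
      (Nat.add_left_cancel h)
    rw [← Fin.cons_self_tail y, ← Fin.cons_self_tail z, h0, ht]

theorem rowMajor_rowMajorIndex {d : ℕ} (s : Fin d → ℕ) (t : ℕ) :
    rowMajor s (rowMajorIndex s t) = t % ∏ i, s i := by
  induction d with
  | zero => simp [rowMajor, Nat.mod_one]
  | succ d ih =>
    have h : Fin.tail (rowMajorIndex s t) = rowMajorIndex (Fin.tail s) t := by
      ext i
      simp [Fin.tail, rowMajorIndex, Fin.prod_Ioi_succ]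
    rw [rowMajor_succ, h, ih, Fin.prod_univ_succ, mul_comm (s 0), Nat.mod_mul]
    simp only [rowMajorIndex, Fin.prod_Ioi_zero, Fin.tail]
    rw [mul_comm, add_comm]

theorem rowMajorIndex_lt {d : ℕ} {s : Fin d → ℕ} (t : ℕ) {i : Fin d} (h : 1 ≤ s i) :
    rowMajorIndex s t i < s i := Nat.mod_lt _ h

theorem rowMajorIndex_rowMajor {d : ℕ} {s y : Fin d → ℕ} (h : ∀ i, y i < s i) :
    rowMajorIndex s (rowMajor s y) = y := by
  refine rowMajor_injective (fun i => rowMajorIndex_lt _ (by have := h i; omega)) h ?_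
  rw [rowMajor_rowMajorIndex, Nat.mod_eq_of_lt (rowMajor_lt h)]

end rowMajor

/-! ### Splitting ordered sums by associativity -/

section orderedSum

variable {V : Type*}

theorem orderedSum_congr (op : V → V → V) {f f' : ℕ → V} {m : ℕ} (h : ∀ t ≤ m, f t = f' t) :
    orderedSum op f m = orderedSum op f' m := by
  induction m with
  | zero => exact h 0 le_rfl
  | succ m ih => rw [orderedSum, orderedSum, ih fun t ht => h t (by omega), h _ le_rfl]

theorem orderedSum_add {op : V → V → V} (hop : ∀ u v w, op (op u v) w = op u (op v w))
    (f : ℕ → V) (a b : ℕ) :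
    orderedSum op f (a + 1 + b)
      = op (orderedSum op f a) (orderedSum op (fun t => f (a + 1 + t)) b) := by
  induction b with
  | zero => rfl
  | succ b ih => rw [← add_assoc, orderedSum, ih, hop, orderedSum, ← add_assoc]

end orderedSum

/-! ### Running lists of instructions -/

section run

variable {V : Type*}

theorem run_append (l₁ l₂ : List (Instr V)) (mem : ℕ → V) :
    run (l₁ ++ l₂) mem = run l₂ (run l₁ mem) := List.foldl_append ..

theorem run_of_forall_dst_ne {l : List (Instr V)} {a : ℕ} (h : ∀ i ∈ l, i.dst ≠ a)
    (mem : ℕ → V) : run l mem a = mem a := by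
  induction l generalizing mem with
  | nil => rfl
  | cons i l ih =>
    change run l (i.exec mem) a = _
    rw [ih (fun j hj => h j (List.mem_cons_of_mem _ hj))]
    exact Function.update_of_ne (h i List.mem_cons_self).symm _ _

/-- Nothing in `l₂` writes to `T`, and `l₁` reads only from `T`, so on `T` the interleaving cannot
be told from `l₁` alone. Two memories are needed for the induction, because they drift apart outside
`T`. -/
theorem run_shuffle {l₁ l₂ l : List (Instr V)} {T : Set ℕ} (h : Shuffle l₁ l₂ l)
    (h₁ : ∀ i ∈ l₁, ∀ t, i.src t ∈ T) (h₂ : ∀ i ∈ l₂, i.dst ∉ T) {mem mem' : ℕ → V}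
    (hm : ∀ a ∈ T, mem a = mem' a) : ∀ a ∈ T, run l mem a = run l₁ mem' a := by
  induction h generalizing mem mem' with
  | nil => exact hm
  | left i _ ih =>
    refine ih (fun j hj => h₁ j (List.mem_cons_of_mem _ hj)) h₂ fun a ha => ?_
    have he : (fun t => mem (i.src t)) = fun t => mem' (i.src t) :=
      funext fun t => hm _ (h₁ i List.mem_cons_self t)
    by_cases hd : a = i.dst
    · subst hd; simp [Instr.exec, he]
    · simp [Instr.exec, hd, hm a ha]
  | right i _ ih =>
    refine ih h₁ (fun j hj => h₂ j (List.mem_cons_of_mem _ hj)) fun a ha => ?_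
    have : a ≠ i.dst := fun e => h₂ i List.mem_cons_self (e ▸ ha)
    simp [Instr.exec, this, hm a ha]

theorem Shuffle.symm {α : Type*} {l₁ l₂ l : List α} (h : Shuffle l₁ l₂ l) :
    Shuffle l₂ l₁ l := by
  induction h with
  | nil => exact .nil
  | left a _ ih => exact .right a ih
  | right a _ ih => exact .left a ih

theorem Shuffle.perm {α : Type*} {l₁ l₂ l : List α} (h : Shuffle l₁ l₂ l) :
    l.Perm (l₁ ++ l₂) := by
  induction h with
  | nil => exact .refl _
  | left a _ ih => exact ih.cons a
  | right a _ ih => exact (ih.cons a).trans List.perm_middle.symm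

/-- Every instruction sees the initial values of its sources, and its result is never overwritten.
The order of the list is irrelevant, which is what makes the parallel addition loop correct under
all schedules. -/
theorem run_of_independent {l : List (Instr V)} (hd : (l.map Instr.dst).Nodup)
    (hs : ∀ i ∈ l, ∀ j ∈ l, ∀ t, i.src t ≠ j.dst) (mem : ℕ → V) {i : Instr V} (hi : i ∈ l) :
    run l mem i.dst = i.f fun t => mem (i.src t) := by
  induction l generalizing mem with
  | nil => simp at hi
  | cons j l ih =>
    rw [List.map_cons, List.nodup_cons] at hd
    change run l (j.exec mem) _ = _
    rcases List.mem_cons.1 hi with rfl | hi'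
    · rw [run_of_forall_dst_ne fun j hj e => hd.1 (by rw [← e]; exact List.mem_map_of_mem hj)]
      simp [Instr.exec]
    · rw [ih hd.2 (fun i hi j hj => hs i (List.mem_cons_of_mem _ hi) j (List.mem_cons_of_mem _ hj))
        _ hi']
      congr 1
      ext t
      exact Function.update_of_ne (hs i hi j List.mem_cons_self t) _ _

/-- The list `l` is an execution of two branches `l₁` and `l₂` of a fork that use the parts `S₁`
and `S₂` of the stack: one after the other, or interleaved and on disjoint parts of the stack. -/
def IsForkOf (l₁ l₂ : List (Instr V)) (S₁ S₂ : Set ℕ) (l : List (Instr V)) : Prop :=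
  l = l₁ ++ l₂ ∨ Shuffle l₁ l₂ l ∧ Disjoint S₁ S₂

theorem IsForkOf.perm {l₁ l₂ l : List (Instr V)} {S₁ S₂ : Set ℕ} (h : IsForkOf l₁ l₂ S₁ S₂ l) :
    l.Perm (l₁ ++ l₂) := by
  rcases h with rfl | h
  · exact .refl _
  · exact h.1.perm

theorem IsForkOf.run_left {l₁ l₂ l : List (Instr V)} {S₁ S₂ U O₁ O₂ : Set ℕ}
    (h : IsForkOf l₁ l₂ S₁ S₂ l) (hs₁ : ∀ i ∈ l₁, ∀ t, i.src t ∈ U ∪ S₁)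
    (hd₂ : ∀ i ∈ l₂, i.dst ∈ O₂ ∪ S₂) (hU : Disjoint U (O₂ ∪ S₂)) (hO : Disjoint O₁ (O₂ ∪ S₂))
    (hS : Disjoint S₁ O₂) (mem : ℕ → V) {a : ℕ} (ha : a ∈ O₁) :
    run l mem a = run l₁ mem a := by
  rcases h with rfl | ⟨h, hSS⟩
  · rw [run_append, run_of_forall_dst_ne]
    rintro i hi rfl
    exact Set.disjoint_left.1 hO ha (hd₂ i hi)
  · refine run_shuffle (T := U ∪ S₁ ∪ O₁) h (fun i hi t => .inl (hs₁ i hi t))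
      (fun i hi hm => ?_) (fun _ _ => rfl) a (.inr ha)
    have := hd₂ i hi
    rcases hm with (hm | hm) | hm
    · exact Set.disjoint_left.1 hU hm this
    · exact Set.disjoint_left.1 (Disjoint.union_right hS hSS) hm this
    · exact Set.disjoint_left.1 hO hm this

/-- In the sequential case the second branch starts in the memory left by the first, which may have
changed the shared stack. Only agreement on `U` survives, hence the existential memory. -/
theorem IsForkOf.run_right {l₁ l₂ l : List (Instr V)} {S₁ S₂ U O₁ O₂ : Set ℕ}
    (h : IsForkOf l₁ l₂ S₁ S₂ l) (hs₂ : ∀ i ∈ l₂, ∀ t, i.src t ∈ U ∪ S₂)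
    (hd₁ : ∀ i ∈ l₁, i.dst ∈ O₁ ∪ S₁) (hU : Disjoint U (O₁ ∪ S₁)) (hO : Disjoint O₂ (O₁ ∪ S₁))
    (hS : Disjoint S₂ O₁) (mem : ℕ → V) :
    ∃ mem', (∀ a ∈ U, mem' a = mem a) ∧ ∀ a ∈ O₂, run l mem a = run l₂ mem' a := by
  rcases h with rfl | ⟨h, hSS⟩
  · refine ⟨run l₁ mem, fun a ha => run_of_forall_dst_ne ?_ _, fun a _ => by rw [run_append]⟩
    rintro i hi rfl
    exact Set.disjoint_left.1 hU ha (hd₁ i hi)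
  · exact ⟨mem, fun _ _ => rfl, fun a ha =>
      IsForkOf.run_left (.inr ⟨h.symm, hSS.symm⟩) hs₂ hd₁ hU hO hS mem ha⟩

end run

/-! ### What the executions of the algorithm touch and compute -/

section boxes

variable {d : ℕ}

/-- The indices of the output entries of a box. -/
def outBox (lo len : Fin (d + 1) → ℕ) : Finset (Fin d → ℕ) :=
  box (fun j => lo j.castSucc) (fun j => len j.castSucc)

/-- The addresses of the output entries of a box. -/
def outSet (lo len : Fin (d + 1) → ℕ) (out : (Fin d → ℕ) → ℕ) : Set ℕ := out '' outBox lo len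

/-- The addresses of the input entries of the cells of a box. -/
def inpSet (inp : Fin d → (Fin d → ℕ) → ℕ) (lo len : Fin (d + 1) → ℕ) : Set ℕ :=
  {a | ∃ j, ∃ x ∈ box lo len, inp j (j.castSucc.removeNth x) = a}

theorem mem_outBox {lo len : Fin (d + 1) → ℕ} {y : Fin d → ℕ} :
    y ∈ outBox lo len ↔ ∀ j, lo j.castSucc ≤ y j ∧ y j < lo j.castSucc + len j.castSucc :=
  mem_box

theorem box_len₁_subset (lo len : Fin (d + 1) → ℕ) (i) : box lo (len₁ len i) ⊆ box lo len := by
  intro x hx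
  rw [mem_box] at *
  intro j
  have h1 := hx j
  have h2 := len₁_le (len := len) (i := i) j
  omega

theorem box_len₂_subset (lo len : Fin (d + 1) → ℕ) (i) :
    box (lo₂ lo len i) (len₂ len i) ⊆ box lo len := by
  intro x hx
  rw [mem_box] at *
  intro j
  have h1 := hx j
  by_cases h : j = i
  · subst h; simp at h1; omega
  · rwa [lo₂_ne h, len₂_ne h] at h1

theorem outBox_len₁_subset (lo len : Fin (d + 1) → ℕ) (i) :
    outBox lo (len₁ len i) ⊆ outBox lo len := by
  intro x hx
  rw [mem_outBox] at *
  intro j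
  have h1 := hx j
  have h2 := len₁_le (len := len) (i := i) j.castSucc
  omega

theorem outBox_len₂_subset (lo len : Fin (d + 1) → ℕ) (i) :
    outBox (lo₂ lo len i) (len₂ len i) ⊆ outBox lo len := by
  intro x hx
  rw [mem_outBox] at *
  intro j
  have h1 := hx j
  by_cases h : j.castSucc = i
  · subst h; simp at h1; omega
  · rwa [lo₂_ne h, len₂_ne h] at h1

theorem outBox_len₁_last (lo len : Fin (d + 1) → ℕ) :
    outBox lo (len₁ len (Fin.last d)) = outBox lo len := by
  ext y; simp [mem_outBox]

theorem outBox_len₂_last (lo len : Fin (d + 1) → ℕ) :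
    outBox (lo₂ lo len (Fin.last d)) (len₂ len (Fin.last d)) = outBox lo len := by
  ext y; simp [mem_outBox]

theorem mem_outBox_halves {lo len : Fin (d + 1) → ℕ} {i} {y : Fin d → ℕ}
    (hy : y ∈ outBox lo len) :
    y ∈ outBox lo (len₁ len i) ∨ y ∈ outBox (lo₂ lo len i) (len₂ len i) := by
  rcases Fin.eq_castSucc_or_eq_last i with ⟨j, rfl⟩ | rfl
  · simp only [mem_outBox] at *
    by_cases h : y j < lo j.castSucc + len j.castSucc / 2
    · left
      intro l
      by_cases hl : l = j
      · subst hl; simp; exact ⟨(hy l).1, h⟩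
      · rw [len₁_ne (by simpa using hl)]; exact hy l
    · right
      intro l
      by_cases hl : l = j
      · subst hl; simp; have := hy l; omega
      · rw [len₂_ne (by simpa using hl), lo₂_ne (by simpa using hl)]; exact hy l
  · rw [outBox_len₁_last]; exact .inl hy

theorem disjoint_outBox_halves (lo len : Fin (d + 1) → ℕ) {i} (hi : i ≠ Fin.last d) :
    Disjoint (outBox lo (len₁ len i)) (outBox (lo₂ lo len i) (len₂ len i)) := by
  obtain ⟨j, rfl⟩ := Fin.exists_castSucc_eq.2 hi
  rw [Finset.disjoint_left]
  intro y h1 h2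
  rw [mem_outBox] at h1 h2
  have h1 := h1 j
  have h2 := h2 j
  simp at h1 h2
  omega

theorem inpSet_len₁_subset (inp : Fin d → (Fin d → ℕ) → ℕ) (lo len : Fin (d + 1) → ℕ) (i) :
    inpSet inp lo (len₁ len i) ⊆ inpSet inp lo len := by
  rintro a ⟨j, x, hx, rfl⟩
  exact ⟨j, x, box_len₁_subset _ _ _ hx, rfl⟩

theorem inpSet_len₂_subset (inp : Fin d → (Fin d → ℕ) → ℕ) (lo len : Fin (d + 1) → ℕ) (i) :
    inpSet inp (lo₂ lo len i) (len₂ len i) ⊆ inpSet inp lo len := by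
  rintro a ⟨j, x, hx, rfl⟩
  exact ⟨j, x, box_len₂_subset _ _ _ hx, rfl⟩

theorem tempAddr_mem {lo len : Fin (d + 1) → ℕ} {y : Fin d → ℕ} (hy : y ∈ outBox lo len)
    (ta : ℕ) : tempAddr ta lo len y ∈ Set.Ico ta (ta + area len) := by
  refine ⟨Nat.le_add_right _ _, Nat.add_lt_add_left (rowMajor_lt fun j => ?_) _⟩
  have := mem_outBox.1 hy j
  omega

theorem outIndex_mem {lo len : Fin (d + 1) → ℕ} (hl : ∀ j, 1 ≤ len j) (t : ℕ) :
    outIndex lo len t ∈ outBox lo len := by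
  rw [mem_outBox]
  intro j
  have := rowMajorIndex_lt (s := fun j => len j.castSucc) t (i := j) (hl j.castSucc)
  simp only [outIndex]
  omega

theorem exists_outIndex_eq {lo len : Fin (d + 1) → ℕ} {y : Fin d → ℕ} (hy : y ∈ outBox lo len) :
    ∃ t < area len, outIndex lo len t = y ∧ ∀ ta, ta + t = tempAddr ta lo len y := by
  have h := mem_outBox.1 hy
  refine ⟨rowMajor (fun j => len j.castSucc) fun j => y j - lo j.castSucc,
    rowMajor_lt fun j => by have := h j; omega, ?_, fun _ => rfl⟩
  ext j
  rw [outIndex, rowMajorIndex_rowMajor fun j => by have := h j; omega]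
  have := h j
  omega

theorem outIndex_injOn (lo len : Fin (d + 1) → ℕ) {t u : ℕ} (ht : t < area len)
    (hu : u < area len) (h : outIndex lo len t = outIndex lo len u) : t = u := by
  have h' : rowMajorIndex (fun j => len j.castSucc) t
      = rowMajorIndex (fun j => len j.castSucc) u := by
    ext j
    have := congrFun h j
    simp only [outIndex] at this
    omega
  have := congrArg (rowMajor fun j => len j.castSucc) h'
  rw [rowMajor_rowMajorIndex, rowMajor_rowMajorIndex] at this
  exact (Nat.mod_eq_of_lt ht).symm.trans (this.trans (Nat.mod_eq_of_lt hu))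

theorem tempAddr_injOn (ta : ℕ) (lo len : Fin (d + 1) → ℕ) :
    Set.InjOn (tempAddr ta lo len) (outBox lo len) := by
  intro y hy z hz h
  obtain ⟨t, _, rfl, h1⟩ := exists_outIndex_eq hy
  obtain ⟨u, _, rfl, h2⟩ := exists_outIndex_eq hz
  have : ta + t = ta + u := by rw [h1, h2, h]
  rw [Nat.add_left_cancel this]

end boxes

/-! ### The specification of a box and its preservation under splits -/

section good

variable {V : Type*} {d : ℕ} {ω : ℝ} {op : V → V → V} {g : (Fin (d + 1) → ℕ) → (Fin d → V) → V}
  {inp : Fin d → (Fin d → ℕ) → ℕ} {lo len : Fin (d + 1) → ℕ} {out : (Fin d → ℕ) → ℕ}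
  {S S₁ S₂ : Set ℕ} {l l₁ l₂ : List (Instr V)} {i : Fin (d + 1)}

/-- The sum of the values of the cells of a box that project to `y`. -/
def boxSum (op : V → V → V) (g : (Fin (d + 1) → ℕ) → (Fin d → V) → V)
    (inp : Fin d → (Fin d → ℕ) → ℕ) (lo len : Fin (d + 1) → ℕ) (mem : ℕ → V) (y : Fin d → ℕ) : V :=
  orderedSum op (fun t => cellValue g (fun j z => mem (inp j z))
    (Fin.snoc (α := fun _ => ℕ) y (lo (Fin.last d) + t))) (len (Fin.last d) - 1)

theorem boxSum_congr (hl : ∀ j, 1 ≤ len j) {mem mem' : ℕ → V}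
    (h : ∀ a ∈ inpSet inp lo len, mem a = mem' a) {y : Fin d → ℕ} (hy : y ∈ outBox lo len) :
    boxSum op g inp lo len mem y = boxSum op g inp lo len mem' y := by
  refine orderedSum_congr op fun t ht => ?_
  unfold cellValue
  congr 1
  ext j
  refine h _ ⟨j, _, mem_box.2 fun i => ?_, rfl⟩
  rcases Fin.eq_castSucc_or_eq_last i with ⟨i, rfl⟩ | rfl
  · simpa using mem_outBox.1 hy i
  · have := hl (Fin.last d)
    simp; omega

theorem boxSum_last (hop : ∀ u v w, op (op u v) w = op u (op v w))
    (h : 2 ≤ len (Fin.last d)) (mem : ℕ → V) (y : Fin d → ℕ) :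
    boxSum op g inp lo len mem y = op (boxSum op g inp lo (len₁ len (Fin.last d)) mem y)
      (boxSum op g inp (lo₂ lo len (Fin.last d)) (len₂ len (Fin.last d)) mem y) := by
  simp only [boxSum, len₁_self, len₂_self, lo₂_self]
  set m := len (Fin.last d)
  rw [show m - 1 = m / 2 - 1 + 1 + (m - m / 2 - 1) by omega, orderedSum_add hop,
    show m / 2 - 1 + 1 = m / 2 by omega]
  simp only [add_assoc]

theorem boxSum_other₁ (hi : i ≠ Fin.last d) :
    boxSum op g inp lo (len₁ len i) = boxSum op g inp lo len := by
  ext mem y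
  simp only [boxSum, len₁_ne hi.symm]

theorem boxSum_other₂ (hi : i ≠ Fin.last d) :
    boxSum op g inp (lo₂ lo len i) (len₂ len i) = boxSum op g inp lo len := by
  ext mem y
  simp only [boxSum, len₂_ne hi.symm, lo₂_ne hi.symm]

/-- The inputs, the outputs and the stack `S` do not overlap. -/
structure Layout (inp : Fin d → (Fin d → ℕ) → ℕ) (lo len : Fin (d + 1) → ℕ)
    (out : (Fin d → ℕ) → ℕ) (S : Set ℕ) : Prop where
  injOn : Set.InjOn out (outBox lo len)
  inp_out : Disjoint (inpSet inp lo len) (outSet lo len out)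
  inp_stack : Disjoint (inpSet inp lo len) S
  out_stack : Disjoint (outSet lo len out) S

/-- The list `l` computes the box with the stack `S`. -/
structure Good (op : V → V → V) (g : (Fin (d + 1) → ℕ) → (Fin d → V) → V)
    (inp : Fin d → (Fin d → ℕ) → ℕ) (lo len : Fin (d + 1) → ℕ) (out : (Fin d → ℕ) → ℕ) (S : Set ℕ)
    (l : List (Instr V)) : Prop where
  dst : ∀ i ∈ l, i.dst ∈ outSet lo len out ∪ S
  src : ∀ i ∈ l, ∀ t, i.src t ∈ inpSet inp lo len ∪ S
  covers : ∀ y ∈ outBox lo len, ∃ i ∈ l, i.dst = out y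
  val : Layout inp lo len out S → ∀ mem, ∀ y ∈ outBox lo len,
    run l mem (out y) = boxSum op g inp lo len mem y

theorem good_cell (h1 : ∀ j, len j = 1) :
    Good op g inp lo len out S [cellInstr g inp lo out] := by
  have hy : ∀ y ∈ outBox lo len, (Fin.last d).removeNth lo = y := by
    intro y hy
    ext j
    have := mem_outBox.1 hy j
    simp only [h1] at this
    simp [Fin.removeNth]
    omega
  refine ⟨?_, ?_, ?_, ?_⟩
  · simp only [List.mem_singleton, forall_eq, cellInstr]
    refine .inl ⟨_, mem_outBox.2 fun j => ?_, rfl⟩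
    simp [Fin.removeNth, h1]
  · simp only [List.mem_singleton, forall_eq]
    exact fun t => .inl ⟨t, lo, mem_box.2 fun i => by simp [h1], rfl⟩
  · intro y h
    exact ⟨_, List.mem_singleton_self _, by rw [← hy y h]; rfl⟩
  · intro _ mem y h
    have hlo : (Fin.snoc (α := fun _ => ℕ) y (lo (Fin.last d)) : Fin (d + 1) → ℕ) = lo := by
      rw [← hy y h]
      ext i
      rcases Fin.eq_castSucc_or_eq_last i with ⟨i, rfl⟩ | rfl <;> simp [Fin.init]
    simp only [boxSum, h1, Nat.sub_self, orderedSum, add_zero, hlo]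
    rw [← hy y h]
    simp [run, Instr.exec, cellInstr, cellValue]

/-- The halves write to disjoint parts of the output, and neither writes to the inputs, so neither
disturbs what the other computes. -/
theorem good_other (hl : ∀ j, 1 ≤ len j) (hi2 : 2 ≤ len i) (hi : i ≠ Fin.last d)
    (hS₁ : S₁ ⊆ S) (hS₂ : S₂ ⊆ S)
    (h₁ : Good op g inp lo (len₁ len i) out S₁ l₁)
    (h₂ : Good op g inp (lo₂ lo len i) (len₂ len i) out S₂ l₂)
    (h : IsForkOf l₁ l₂ S₁ S₂ l) : Good op g inp lo len out S l := by
  have hI₁ := inpSet_len₁_subset inp lo len i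
  have hI₂ := inpSet_len₂_subset inp lo len i
  have hO₁ : outSet lo (len₁ len i) out ⊆ outSet lo len out :=
    Set.image_mono (Finset.coe_subset.2 (outBox_len₁_subset lo len i))
  have hO₂ : outSet (lo₂ lo len i) (len₂ len i) out ⊆ outSet lo len out :=
    Set.image_mono (Finset.coe_subset.2 (outBox_len₂_subset lo len i))
  have hmem : ∀ {x}, x ∈ l ↔ x ∈ l₁ ∨ x ∈ l₂ := fun {x} => by
    rw [h.perm.mem_iff, List.mem_append]
  refine ⟨fun x hx => ?_, fun x hx t => ?_, fun y hy => ?_, fun hL mem y hy => ?_⟩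
  · rcases hmem.1 hx with hx | hx
    · exact Set.union_subset_union hO₁ hS₁ (h₁.dst x hx)
    · exact Set.union_subset_union hO₂ hS₂ (h₂.dst x hx)
  · rcases hmem.1 hx with hx | hx
    · exact Set.union_subset_union hI₁ hS₁ (h₁.src x hx t)
    · exact Set.union_subset_union hI₂ hS₂ (h₂.src x hx t)
  · rcases mem_outBox_halves (i := i) hy with hy | hy
    · obtain ⟨x, hx, hxy⟩ := h₁.covers y hy
      exact ⟨x, hmem.2 (.inl hx), hxy⟩
    · obtain ⟨x, hx, hxy⟩ := h₂.covers y hy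
      exact ⟨x, hmem.2 (.inr hx), hxy⟩
  · have hOO : Disjoint (outSet lo (len₁ len i) out)
        (outSet (lo₂ lo len i) (len₂ len i) out) := by
      refine Disjoint.image (Finset.disjoint_coe.2 (disjoint_outBox_halves lo len hi)) hL.injOn
        (Finset.coe_subset.2 (outBox_len₁_subset lo len i))
        (Finset.coe_subset.2 (outBox_len₂_subset lo len i))
    have hL₁ : Layout inp lo (len₁ len i) out S₁ :=
      ⟨hL.injOn.mono (Finset.coe_subset.2 (outBox_len₁_subset lo len i)),
        hL.inp_out.mono hI₁ hO₁, hL.inp_stack.mono hI₁ hS₁, hL.out_stack.mono hO₁ hS₁⟩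
    have hL₂ : Layout inp (lo₂ lo len i) (len₂ len i) out S₂ :=
      ⟨hL.injOn.mono (Finset.coe_subset.2 (outBox_len₂_subset lo len i)),
        hL.inp_out.mono hI₂ hO₂, hL.inp_stack.mono hI₂ hS₂, hL.out_stack.mono hO₂ hS₂⟩
    rcases mem_outBox_halves (i := i) hy with hy | hy
    · rw [h.run_left h₁.src h₂.dst
        (Disjoint.union_right (hL.inp_out.mono hI₁ hO₂) (hL.inp_stack.mono hI₁ hS₂))
        (Disjoint.union_right hOO (hL.out_stack.mono hO₁ hS₂))
        (hL.out_stack.mono hO₂ hS₁).symm mem (Set.mem_image_of_mem _ hy), h₁.val hL₁ _ y hy,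
        boxSum_other₁ hi]
    · obtain ⟨mem', hm, hr⟩ := h.run_right h₂.src h₁.dst
        (Disjoint.union_right (hL.inp_out.mono hI₂ hO₁) (hL.inp_stack.mono hI₂ hS₁))
        (Disjoint.union_right hOO.symm (hL.out_stack.mono hO₂ hS₁))
        (hL.out_stack.mono hO₁ hS₂).symm mem
      rw [hr _ (Set.mem_image_of_mem _ hy), h₂.val hL₂ _ y hy,
        boxSum_congr (one_le_len₂ hl hi2) hm hy, boxSum_other₂ hi]

theorem run_addLoop (hl : ∀ j, 1 ≤ len j) {ta tb : ℕ}
    (hinj : Set.InjOn out (outBox lo len))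
    (ha : Disjoint (outSet lo len out) (Set.Ico ta (ta + area len)))
    (hb : Disjoint (outSet lo len out) (Set.Ico tb (tb + area len)))
    (h : l.Perm ((List.range' 0 (area len)).map (addInstr op lo len out ta tb)))
    (mem : ℕ → V) {y : Fin d → ℕ} (hy : y ∈ outBox lo len) :
    run l mem (out y) = op (mem (tempAddr ta lo len y)) (mem (tempAddr tb lo len y)) := by
  have hdst : ∀ t, out (outIndex lo len t) ∈ outSet lo len out := fun t =>
    Set.mem_image_of_mem _ (outIndex_mem hl t)
  obtain ⟨t, ht, rfl, hty⟩ := exists_outIndex_eq hy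
  have hr := run_of_independent (l := l) ?_ ?_ mem (i := addInstr op lo len out ta tb t) ?_
  · simpa [addInstr, hty] using hr
  · rw [(h.map Instr.dst).nodup_iff, List.map_map]
    refine (List.nodup_range').map_on ?_
    intro u hu v hv huv
    simp only [List.mem_range'_1, zero_le, zero_add, true_and] at hu hv
    exact outIndex_injOn lo len hu hv (hinj (outIndex_mem hl u) (outIndex_mem hl v) huv)
  · intro i hi j hj s
    rw [h.mem_iff, List.mem_map] at hi hj
    obtain ⟨u, hu, rfl⟩ := hi
    obtain ⟨v, hv, rfl⟩ := hj
    simp only [List.mem_range'_1, zero_le, zero_add, true_and] at hu hv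
    fin_cases s
    · intro e
      refine Set.disjoint_left.1 ha (hdst v) ?_
      rw [show out (outIndex lo len v) = ta + u from e.symm]
      exact ⟨Nat.le_add_right _ _, Nat.add_lt_add_left hu _⟩
    · intro e
      refine Set.disjoint_left.1 hb (hdst v) ?_
      rw [show out (outIndex lo len v) = tb + u from e.symm]
      exact ⟨Nat.le_add_right _ _, Nat.add_lt_add_left hu _⟩
  · rw [h.mem_iff]
    exact List.mem_map_of_mem (by simpa using ht)

/-- For the halves the temporary arrays are the outputs; for the parent they belong to the stack
`S`. The loop then adds them, and associativity identifies the result with the sum over the whole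
last dimension. -/
theorem good_last (hop : ∀ u v w, op (op u v) w = op u (op v w)) (hl : ∀ j, 1 ≤ len j)
    (hi2 : 2 ≤ len (Fin.last d)) {ta tb : ℕ} {lf ll : List (Instr V)}
    (hta : Set.Ico ta (ta + area len) ⊆ S) (htb : Set.Ico tb (tb + area len) ⊆ S)
    (hab : Disjoint (Set.Ico ta (ta + area len)) (Set.Ico tb (tb + area len)))
    (hS₁ : S₁ ⊆ S) (hS₂ : S₂ ⊆ S)
    (ha₁ : Disjoint (Set.Ico ta (ta + area len)) S₁)
    (ha₂ : Disjoint (Set.Ico ta (ta + area len)) S₂)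
    (hb₁ : Disjoint (Set.Ico tb (tb + area len)) S₁)
    (hb₂ : Disjoint (Set.Ico tb (tb + area len)) S₂)
    (h₁ : Good op g inp lo (len₁ len (Fin.last d)) (tempAddr ta lo len) S₁ l₁)
    (h₂ : Good op g inp (lo₂ lo len (Fin.last d)) (len₂ len (Fin.last d))
      (tempAddr tb lo len) S₂ l₂)
    (h : IsForkOf l₁ l₂ S₁ S₂ lf)
    (hll : ll.Perm ((List.range' 0 (area len)).map (addInstr op lo len out ta tb))) :
    Good op g inp lo len out S (lf ++ ll) := by
  have hI₁ := inpSet_len₁_subset inp lo len (Fin.last d)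
  have hI₂ := inpSet_len₂_subset inp lo len (Fin.last d)
  have hO₁ : outSet lo (len₁ len (Fin.last d)) (tempAddr ta lo len)
      ⊆ Set.Ico ta (ta + area len) := by
    rintro _ ⟨y, hy, rfl⟩
    rw [outBox_len₁_last] at hy
    exact tempAddr_mem hy ta
  have hO₂ : outSet (lo₂ lo len (Fin.last d)) (len₂ len (Fin.last d)) (tempAddr tb lo len)
      ⊆ Set.Ico tb (tb + area len) := by
    rintro _ ⟨y, hy, rfl⟩
    rw [outBox_len₂_last] at hy
    exact tempAddr_mem hy tb
  have hmem : ∀ {x}, x ∈ lf ↔ x ∈ l₁ ∨ x ∈ l₂ := fun {x} => by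
    rw [h.perm.mem_iff, List.mem_append]
  have hloop : ∀ {x}, x ∈ ll ↔ ∃ t < area len, addInstr op lo len out ta tb t = x :=
    fun {x} => by simp [hll.mem_iff]
  refine ⟨fun x hx => ?_, fun x hx t => ?_, fun y hy => ?_, fun hL mem y hy => ?_⟩
  · rcases List.mem_append.1 hx with hx | hx
    · right
      rcases hmem.1 hx with hx | hx
      · exact Set.union_subset (hO₁.trans hta) hS₁ (h₁.dst x hx)
      · exact Set.union_subset (hO₂.trans htb) hS₂ (h₂.dst x hx)
    · obtain ⟨t, _, rfl⟩ := hloop.1 hx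
      exact .inl (Set.mem_image_of_mem _ (outIndex_mem hl t))
  · rcases List.mem_append.1 hx with hx | hx
    · rcases hmem.1 hx with hx | hx
      · exact Set.union_subset_union hI₁ hS₁ (h₁.src x hx t)
      · exact Set.union_subset_union hI₂ hS₂ (h₂.src x hx t)
    · right
      obtain ⟨u, hu, rfl⟩ := hloop.1 hx
      change Fin 2 at t
      fin_cases t
      · exact hta ⟨Nat.le_add_right _ _, Nat.add_lt_add_left hu ta⟩
      · exact htb ⟨Nat.le_add_right _ _, Nat.add_lt_add_left hu tb⟩
  · obtain ⟨t, ht, rfl, -⟩ := exists_outIndex_eq hy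
    exact ⟨_, List.mem_append_right _ (hloop.2 ⟨t, ht, rfl⟩), rfl⟩
  · have hL₁ : Layout inp lo (len₁ len (Fin.last d)) (tempAddr ta lo len) S₁ :=
      ⟨by rw [outBox_len₁_last]; exact tempAddr_injOn _ _ _,
        hL.inp_stack.mono hI₁ (hO₁.trans hta), hL.inp_stack.mono hI₁ hS₁, ha₁.mono_left hO₁⟩
    have hL₂ : Layout inp (lo₂ lo len (Fin.last d)) (len₂ len (Fin.last d))
        (tempAddr tb lo len) S₂ :=
      ⟨by rw [outBox_len₂_last]; exact tempAddr_injOn _ _ _,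
        hL.inp_stack.mono hI₂ (hO₂.trans htb), hL.inp_stack.mono hI₂ hS₂, hb₂.mono_left hO₂⟩
    have hy₁ : y ∈ outBox lo (len₁ len (Fin.last d)) := by rwa [outBox_len₁_last]
    have hy₂ : y ∈ outBox (lo₂ lo len (Fin.last d)) (len₂ len (Fin.last d)) := by
      rwa [outBox_len₂_last]
    rw [run_append, run_addLoop hl hL.injOn (hL.out_stack.mono_right hta)
      (hL.out_stack.mono_right htb) hll _ hy, boxSum_last hop hi2]
    congr 1
    · rw [h.run_left h₁.src h₂.dst
        (Disjoint.union_right (hL.inp_stack.mono hI₁ (hO₂.trans htb))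
          (hL.inp_stack.mono hI₁ hS₂))
        (Disjoint.union_right (hab.mono hO₁ hO₂) (ha₂.mono_left hO₁))
        (hb₁.mono_left hO₂).symm mem (Set.mem_image_of_mem _ hy₁), h₁.val hL₁ _ y hy₁]
    · obtain ⟨mem', hm, hr⟩ := h.run_right h₂.src h₁.dst
        (Disjoint.union_right (hL.inp_stack.mono hI₂ (hO₁.trans hta))
          (hL.inp_stack.mono hI₂ hS₁))
        (Disjoint.union_right (hab.symm.mono hO₂ hO₁) (hb₁.mono_left hO₂))
        (ha₂.mono_left hO₁).symm mem
      rw [hr _ (Set.mem_image_of_mem _ hy₂), h₂.val hL₂ _ y hy₂,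
        boxSum_congr (one_le_len₂ hl hi2) hm hy₂]

end good

/-! ### Correctness -/

section correctness

variable {V : Type*} {d : ℕ} (ω : ℝ) {op : V → V → V} (g : (Fin (d + 1) → ℕ) → (Fin d → V) → V)
  (inp : Fin d → (Fin d → ℕ) → ℕ)

/-- The number of stack words of the sequential execution. -/
def Prog.seqSpace : Prog V → ℕ → ℕ
  | skip, _ => 0
  | instr _, _ => 0
  | seq p q, sp => max (p.seqSpace sp) (q.seqSpace sp)
  | fork p q, sp => max (p.seqSpace sp) (q.seqSpace sp)
  | alloc s body, sp => s + (body sp).seqSpace (sp + s)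

theorem Prog.trace_parFor_instr (F : ℕ → Instr V) (lo len sp : ℕ) :
    (Prog.parFor (fun t => .instr (F t)) lo len).trace sp = (List.range' lo len).map F := by
  refine Prog.parFor_induction
    (motive := fun lo len p => p.trace sp = (List.range' lo len).map F) _ ?_ ?_ ?_ lo len
  · intro lo; simp [Prog.trace]
  · intro lo; simp [Prog.trace]
  · intro lo a b p q _ _ _ hp hq
    rw [Prog.trace, hp, hq, ← List.map_append, List.range'_append_1]

theorem Prog.seqSpace_parFor_instr (F : ℕ → Instr V) (lo len sp : ℕ) :
    (Prog.parFor (fun t => .instr (F t)) lo len).seqSpace sp = 0 := by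
  refine Prog.parFor_induction
    (motive := fun _ _ p => p.seqSpace sp = 0) _ ?_ ?_ ?_ lo len
  · intro lo; simp [Prog.seqSpace]
  · intro lo; simp [Prog.seqSpace]
  · intro lo a b p q _ _ _ hp hq
    rw [Prog.seqSpace, hp, hq, max_self]

theorem Prog.perm_of_isSchedule_parFor_instr (F : ℕ → Instr V) (lo len : ℕ) {sp : ℕ}
    {l : List (Instr V)} (h : (Prog.parFor (fun t => .instr (F t)) lo len).IsSchedule sp l) :
    l.Perm ((List.range' lo len).map F) := by
  revert sp l
  refine Prog.parFor_induction
    (motive := fun lo len p => ∀ {sp l}, p.IsSchedule sp l → l.Perm ((List.range' lo len).map F))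
    _ ?_ ?_ ?_ lo len
  · rintro lo sp l h
    simp only [Prog.IsSchedule] at h
    simp [h]
  · rintro lo sp l h
    simp only [Prog.IsSchedule] at h
    simp [h]
  · rintro lo a b p q _ _ _ hp hq sp l ⟨l₁, l₂, h₁, h₂, h⟩
    rw [← List.range'_append_1, List.map_append]
    exact h.perm.trans ((hp h₁).append (hq h₂))

theorem good_trace (hop : ∀ u v w, op (op u v) w = op u (op v w)) (lo len : Fin (d + 1) → ℕ)
    (hl : ∀ j, 1 ≤ len j) (out : (Fin d → ℕ) → ℕ) (sp : ℕ) :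
    Good op g inp lo len out
      (Set.Ico sp (sp + (asymAlg ω op g inp lo len out).seqSpace sp))
      ((asymAlg ω op g inp lo len out).trace sp) := by
  revert out sp
  refine box_induction ω (motive := fun lo len => ∀ out sp, Good op g inp lo len out
      (Set.Ico sp (sp + (asymAlg ω op g inp lo len out).seqSpace sp))
      ((asymAlg ω op g inp lo len out).trace sp)) ?_ ?_ lo len hl
  · intro lo len h1 h out sp
    rw [asymAlg_none _ _ _ _ _ _ h]
    exact good_cell h1
  · intro lo len i hl hi h ih1 ih2 out sp
    by_cases hil : i = Fin.last d
    · subst hil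
      rw [asymAlg_last _ _ _ _ _ _ h]
      simp only [Prog.trace, Prog.seqSpace, Prog.trace_parFor_instr, Prog.seqSpace_parFor_instr]
      have h1 := ih1 (tempAddr sp lo len) (sp + area len + area len)
      have h2 := ih2 (tempAddr (sp + area len) lo len) (sp + area len + area len)
      refine good_last hop hl hi ?_ ?_ ?_ ?_ ?_ ?_ ?_ ?_ ?_ h1 h2 (.inl rfl) (.refl _)
      · exact Set.Ico_subset_Ico le_rfl (by omega)
      · exact Set.Ico_subset_Ico (by omega) (by omega)
      · exact Set.Ico_disjoint_Ico_same
      · exact Set.Ico_subset_Ico (by omega) (by omega)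
      · exact Set.Ico_subset_Ico (by omega) (by omega)
      · exact Set.Ico_disjoint_Ico.2 (by omega)
      · exact Set.Ico_disjoint_Ico.2 (by omega)
      · exact Set.Ico_disjoint_Ico_same
      · exact Set.Ico_disjoint_Ico_same
    · rw [asymAlg_other _ _ _ _ _ _ h hil]
      exact good_other hl hi hil (Set.Ico_subset_Ico le_rfl (by simp [Prog.seqSpace]))
        (Set.Ico_subset_Ico le_rfl (by simp [Prog.seqSpace])) (ih1 out sp) (ih2 out sp) (.inl rfl)

theorem good_of_isSchedule (hop : ∀ u v w, op (op u v) w = op u (op v w))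
    (lo len : Fin (d + 1) → ℕ) (hl : ∀ j, 1 ≤ len j) (out : (Fin d → ℕ) → ℕ) (sp : ℕ)
    (l : List (Instr V)) (h : (asymAlg ω op g inp lo len out).IsSchedule sp l) :
    Good op g inp lo len out
      (Set.Ico sp (sp + (asymAlg ω op g inp lo len out).parSpace sp)) l := by
  revert out sp l
  refine box_induction ω (motive := fun lo len => ∀ out sp l,
    (asymAlg ω op g inp lo len out).IsSchedule sp l → Good op g inp lo len out
      (Set.Ico sp (sp + (asymAlg ω op g inp lo len out).parSpace sp)) l) ?_ ?_ lo len hl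
  · intro lo len h1 h out sp l hs
    rw [asymAlg_none _ _ _ _ _ _ h] at hs ⊢
    simp only [Prog.IsSchedule] at hs
    subst hs
    exact good_cell h1
  · intro lo len i hl hi h ih1 ih2 out sp l hs
    by_cases hil : i = Fin.last d
    · subst hil
      rw [asymAlg_last _ _ _ _ _ _ h] at hs ⊢
      simp only [Prog.IsSchedule, Prog.parSpace] at hs ⊢
      obtain ⟨lf, ll, ⟨l₁, l₂, hs₁, hs₂, hsh⟩, hll, rfl⟩ := hs
      have h1 := ih1 _ _ _ hs₁
      have h2 := ih2 _ _ _ hs₂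
      refine good_last hop hl hi ?_ ?_ ?_ ?_ ?_ ?_ ?_ ?_ ?_ h1 h2
        (.inr ⟨hsh, Set.Ico_disjoint_Ico_same⟩) (Prog.perm_of_isSchedule_parFor_instr _ _ _ hll)
      · exact Set.Ico_subset_Ico le_rfl (by omega)
      · exact Set.Ico_subset_Ico (by omega) (by omega)
      · exact Set.Ico_disjoint_Ico_same
      · exact Set.Ico_subset_Ico (by omega) (by omega)
      · exact Set.Ico_subset_Ico (by omega) (by omega)
      · exact Set.Ico_disjoint_Ico.2 (by omega)
      · exact Set.Ico_disjoint_Ico.2 (by omega)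
      · exact Set.Ico_disjoint_Ico_same
      · exact Set.Ico_disjoint_Ico.2 (by omega)
    · rw [asymAlg_other _ _ _ _ _ _ h hil] at hs ⊢
      simp only [Prog.IsSchedule, Prog.parSpace] at hs ⊢
      obtain ⟨l₁, l₂, hs₁, hs₂, hsh⟩ := hs
      exact good_other hl hi hil (Set.Ico_subset_Ico le_rfl (by omega))
        (Set.Ico_subset_Ico (by omega) (by omega)) (ih1 out sp _ hs₁) (ih2 out _ _ hs₂)
        (.inr ⟨hsh, Set.Ico_disjoint_Ico_same⟩)

theorem rowMajor_square_lt {n : ℕ} {y : Fin d → ℕ} (h : ∀ j, y j < n) :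
    rowMajor (fun _ => n) y < n ^ d := by
  simpa using rowMajor_lt (s := fun _ => n) h

theorem layout_grid (n : ℕ) (hi : ℕ) :
    Layout (d := d) (inputAddr n) (fun _ => 0) (fun _ => n) (outputAddr n)
      (Set.Ico (stackBase d n) hi) := by
  have hin : ∀ a ∈ inpSet (d := d) (inputAddr n) (fun _ => 0) (fun _ => n), a < d * n ^ d := by
    rintro _ ⟨j, x, hx, rfl⟩
    rw [mem_box] at hx
    have h1 : rowMajor (fun _ => n) (j.castSucc.removeNth x) < n ^ d :=
      rowMajor_square_lt fun l => by
        have := (hx (j.castSucc.succAbove l)).2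
        simpa [Fin.removeNth] using this
    have h2 : ((j : ℕ) + 1) * n ^ d ≤ d * n ^ d := Nat.mul_le_mul_right _ j.2
    rw [add_mul] at h2
    simp only [inputAddr]
    omega
  have hout : ∀ a ∈ outSet (d := d) (fun _ => 0) (fun _ => n) (outputAddr n),
      d * n ^ d ≤ a ∧ a < stackBase d n := by
    rintro _ ⟨y, hy, rfl⟩
    have h1 : rowMajor (fun _ => n) y < n ^ d := rowMajor_square_lt fun l => by
      have := (mem_outBox.1 hy l).2
      omega
    simp only [outputAddr, stackBase, add_mul]
    omega
  have hle : d * n ^ d ≤ stackBase d n := Nat.mul_le_mul_right _ (by omega)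
  refine ⟨fun y hy z hz h => ?_, ?_, ?_, ?_⟩
  · exact rowMajor_injective (s := fun _ => n)
      (fun l => by have := (mem_outBox.1 hy l).2; omega)
      (fun l => by have := (mem_outBox.1 hz l).2; omega) (Nat.add_left_cancel h)
  · exact Set.disjoint_left.2 fun a h1 h2 => by have := hin a h1; have := hout a h2; omega
  · exact Set.disjoint_left.2 fun a h1 h2 => by have := hin a h1; have := h2.1; omega
  · exact Set.disjoint_left.2 fun a h1 h2 => by have := hout a h1; have := h2.1; omega

theorem computes_of_good {n hi : ℕ} {l : List (Instr V)} (h : Good (d := d) op g (inputAddr n)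
      (fun _ => 0) (fun _ => n) (outputAddr n) (Set.Ico (stackBase d n) hi) l) :
    Computes op g n l := by
  intro mem y hy
  rw [h.val (layout_grid n hi) mem y (mem_outBox.2 fun j => by simpa using hy j)]
  simp [boxSum, gridOutput]

theorem computes_trace (hop : ∀ u v w, op (op u v) w = op u (op v w)) {n : ℕ} (hn : 1 ≤ n) :
    Computes op g n ((gridProg ω op g n).trace (stackBase d n)) :=
  computes_of_good g (good_trace ω g _ hop _ _ (fun _ => hn) _ _)

theorem computes_of_isSchedule (hop : ∀ u v w, op (op u v) w = op u (op v w)) {n : ℕ}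
    (hn : 1 ≤ n) {l : List (Instr V)} (hl : (gridProg ω op g n).IsSchedule (stackBase d n) l) :
    Computes op g n l :=
  computes_of_good g (good_of_isSchedule ω g _ hop _ _ (fun _ => hn) _ _ l hl)

end correctness

/-! ### Lower bound for the cache complexity -/

section lower

variable {V : Type*} {M B : ℕ}

theorem card_box {m : ℕ} (a n : Fin m → ℕ) : (box a n).card = ∏ i, n i := by
  simp [box]

/-- The lines that a list of instructions writes to. -/
def dstLines (B : ℕ) (l : List (Instr V)) : Finset ℕ := (l.map fun i => i.dst / B).toFinset

theorem dstLines_cons (i : Instr V) (l : List (Instr V)) :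
    dstLines B (i :: l) = insert (i.dst / B) (dstLines B l) := by
  simp [dstLines]

/-- A line ceases to be dirty only through a write-back, and none is dirty at the end. -/
theorem CacheRun.card_dstLines_le {C D : Finset ℕ} {l : List (Instr V)} {r w : ℕ}
    (h : CacheRun M B C D l r w) : (D ∪ dstLines B l).card ≤ w := by
  induction h with
  | done C => simp [dstLines]
  | load x hx hroom h ih => exact ih
  | drop x hx hD h ih => exact ih
  | @writeBack C D l r w x hx h ih =>
    refine le_trans ?_ (Nat.succ_le_succ ih)
    refine le_trans (Finset.card_le_card (t := insert x (D.erase x ∪ dstLines B l)) ?_)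
      (Finset.card_insert_le _ _)
    rw [← Finset.insert_union, Finset.insert_erase hx]
  | step i hi h ih => rwa [dstLines_cons, Finset.union_insert, ← Finset.insert_union]

/-- The execution is cut after `l₁`. Every line that was dirty before or modified by `l₁` is either
still dirty at the cut or has been written back, which is the final inequality. -/
theorem CacheRun.exists_of_append {C D : Finset ℕ} {l₁ l₂ : List (Instr V)} {r w : ℕ}
    (h : CacheRun M B C D (l₁ ++ l₂) r w) (hDC : D ⊆ C) (hC : C.card * B ≤ M) :
    ∃ C' D' r' w', D' ⊆ C' ∧ C'.card * B ≤ M ∧ CacheRun M B C' D' l₂ r' w' ∧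
      D' ⊆ D ∪ dstLines B l₁ ∧ (D ∪ dstLines B l₁).card + w' ≤ D'.card + w := by
  generalize hl : l₁ ++ l₂ = l at h
  induction h generalizing l₁ with
  | done C =>
    obtain ⟨rfl, rfl⟩ := List.append_eq_nil_iff.1 hl
    exact ⟨C, ∅, 0, 0, hDC, hC, .done C, by simp, by simp [dstLines]⟩
  | @load C D l r w x hx hroom h ih =>
    exact ih (hDC.trans (Finset.subset_insert _ _))
      (by rwa [Finset.card_insert_of_notMem hx]) hl
  | @drop C D l r w x hx hD h ih =>
    exact ih (Finset.subset_erase.2 ⟨hDC, hD⟩)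
      (le_trans (Nat.mul_le_mul_right _ (Finset.card_le_card (Finset.erase_subset _ _))) hC) hl
  | @writeBack C D l r w x hx h ih =>
    obtain ⟨C', D', r', w', h1, h2, h3, h5, h4⟩ := ih ((Finset.erase_subset _ _).trans hDC) hC hl
    refine ⟨C', D', r', w', h1, h2, h3,
      h5.trans (Finset.union_subset_union (Finset.erase_subset _ _) subset_rfl), ?_⟩
    have : (D ∪ dstLines B l₁).card ≤ (D.erase x ∪ dstLines B l₁).card + 1 := by
      refine le_trans (Finset.card_le_card (t := insert x (D.erase x ∪ dstLines B l₁)) ?_)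
        (Finset.card_insert_le _ _)
      rw [← Finset.insert_union, Finset.insert_erase hx]
    omega
  | @step C D l r w i hi h ih =>
    have hiC : i.dst / B ∈ C := hi (Finset.mem_insert_self _ _)
    cases l₁ with
    | nil =>
      obtain rfl : l₂ = i :: l := by simpa using hl
      exact ⟨C, D, r, w, hDC, hC, .step i hi h, by simp, by simp [dstLines]⟩
    | cons j l₁ =>
      obtain rfl : j = i := (List.cons.inj hl).1
      rw [dstLines_cons, Finset.union_insert, ← Finset.insert_union]
      exact ih (Finset.insert_subset hiC hDC) hC (List.cons.inj hl).2

/-- Executing `l` takes at least `N` writes, whatever precedes and follows. -/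
def NeedsWrites (M B : ℕ) (l : List (Instr V)) (N : ℝ) : Prop :=
  ∀ ⦃C D : Finset ℕ⦄ ⦃rest : List (Instr V)⦄ ⦃r w : ℕ⦄, CacheRun M B C D (l ++ rest) r w → D ⊆ C →
    C.card * B ≤ M → ∃ C' D' r' w', D' ⊆ C' ∧ C'.card * B ≤ M ∧ CacheRun M B C' D' rest r' w' ∧
      N + w' ≤ w

theorem NeedsWrites.append {l₁ l₂ : List (Instr V)} {N₁ N₂ : ℝ} (h₁ : NeedsWrites M B l₁ N₁)
    (h₂ : NeedsWrites M B l₂ N₂) : NeedsWrites M B (l₁ ++ l₂) (N₁ + N₂) := by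
  intro C D rest r w h hDC hC
  rw [List.append_assoc] at h
  obtain ⟨C', D', r', w', hDC', hC', h', hw'⟩ := h₁ h hDC hC
  obtain ⟨C'', D'', r'', w'', hDC'', hC'', h'', hw''⟩ := h₂ h' hDC' hC'
  exact ⟨C'', D'', r'', w'', hDC'', hC'', h'', by linarith⟩

theorem NeedsWrites.mono {l : List (Instr V)} {N N' : ℝ} (h : NeedsWrites M B l N) (hN : N' ≤ N) :
    NeedsWrites M B l N' := by
  intro C D rest r w h' hDC hC
  obtain ⟨C', D', r', w', hDC', hC', h', hw'⟩ := h h' hDC hC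
  exact ⟨C', D', r', w', hDC', hC', h', by linarith⟩

/-- The lines that are still dirty afterwards lie in the cache, which has room for only M / B lines.
-/
theorem needsWrites_of_card (l : List (Instr V)) (hB : 1 ≤ B) :
    NeedsWrites M B l ((dstLines B l).card - M / B) := by
  intro C D rest r w h hDC hC
  obtain ⟨C', D', r', w', hDC', hC', h', hD', hw'⟩ := h.exists_of_append hDC hC
  refine ⟨C', D', r', w', hDC', hC', h', ?_⟩
  have h1 := Finset.card_le_card (Finset.subset_union_right (s₁ := D) (s₂ := dstLines B l))
  have h2 : (D'.card : ℝ) ≤ M / B := by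
    rw [le_div_iff₀ (by exact_mod_cast hB)]
    exact_mod_cast (Nat.mul_le_mul_right B (Finset.card_le_card hDC')).trans hC'
  have h3 : ((dstLines B l).card : ℝ) + w' ≤ D'.card + w := by
    exact_mod_cast (Nat.add_le_add_right h1 w').trans hw'
  linarith

theorem zero_needsWrites (l : List (Instr V)) : NeedsWrites M B l 0 := by
  intro C D rest r w h hDC hC
  obtain ⟨C', D', r', w', hDC', hC', h', hD', hw'⟩ := h.exists_of_append hDC hC
  refine ⟨C', D', r', w', hDC', hC', h', ?_⟩
  have := Finset.card_le_card hD'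
  have : w' ≤ w := by omega
  simpa using this

/-- Every output entry is written by some instruction, the entries have distinct addresses, and a
line holds only `B` of them. -/
theorem card_le_mul_card_dstLines {d : ℕ} {op : V → V → V}
    {g : (Fin (d + 1) → ℕ) → (Fin d → V) → V} {inp : Fin d → (Fin d → ℕ) → ℕ}
    {lo len : Fin (d + 1) → ℕ} {out : (Fin d → ℕ) → ℕ} {S : Set ℕ} {l : List (Instr V)}
    (h : Good op g inp lo len out S l) (hinj : Set.InjOn out (outBox lo len)) (hB : 1 ≤ B) :
    area len ≤ B * (dstLines B l).card := by
  classical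
  have h1 : ((outBox lo len).image out).card = area len := by
    rw [Finset.card_image_of_injOn hinj, outBox, card_box, area]
  rw [← h1]
  refine (Finset.card_le_mul_card_image (f := fun a => a / B) _ B fun b _ => ?_).trans
    (Nat.mul_le_mul_left B (Finset.card_le_card ?_))
  · refine (Finset.card_le_card (t := Finset.Ico (b * B) (b * B + B)) fun a ha => ?_).trans
      (by simp)
    obtain ⟨-, rfl⟩ := Finset.mem_filter.1 ha
    exact Finset.mem_Ico.2 ⟨Nat.div_mul_le_self a B, Nat.lt_div_mul_add hB⟩
  · intro b hb
    simp only [Finset.mem_image, exists_exists_and_eq_and] at hb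
    obtain ⟨y, hy, rfl⟩ := hb
    obtain ⟨i, hi, hiy⟩ := h.covers y hy
    rw [dstLines, List.mem_toFinset, List.mem_map]
    exact ⟨i, hi, by rw [hiy]⟩

variable {d : ℕ} {ω : ℝ} {op : V → V → V} (g : (Fin (d + 1) → ℕ) → (Fin d → V) → V)
  (inp : Fin d → (Fin d → ℕ) → ℕ)

theorem dimWeight_castSucc (ω : ℝ) (j : Fin d) : dimWeight ω j.castSucc = 1 :=
  if_neg (Fin.castSucc_lt_last j).ne

theorem le_mul_dimWeight_of_pickDim {len : Fin (d + 1) → ℕ} {j : Fin d}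
    (h : pickDim ω len = some j.castSucc) (hm : 2 ≤ len (Fin.last d)) :
    (len (Fin.last d) : ℝ) * dimWeight ω (Fin.last d) ≤ len j.castSucc := by
  have := le_of_pickDim h hm
  rwa [dimWeight_castSucc, mul_one] at this

/-- The bound is additive over halves, so it suffices to reach a last extent of at most 5sq without
the other extents falling below 2s. -/
theorem needsWrites_trace (hop : ∀ u v w, op (op u v) w = op u (op v w)) (hd : 1 ≤ d) {s q : ℝ}
    (hs : 1 ≤ s) (hsM : s ^ d = M) (hB : 1 ≤ B) (hq : 1 ≤ q)
    (hw : dimWeight ω (Fin.last d) = q⁻¹) (lo len : Fin (d + 1) → ℕ) (hl : ∀ j, 1 ≤ len j)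
    (hlen : ∀ j : Fin d, 2 * s ≤ len j.castSucc) (out : (Fin d → ℕ) → ℕ)
    (hinj : Set.InjOn out (outBox lo len)) (sp : ℕ) :
    NeedsWrites M B ((asymAlg ω op g inp lo len out).trace sp) (vol len / (10 * s * q * B)) := by
  revert hlen out hinj sp
  refine box_induction ω (motive := fun lo len => (∀ j : Fin d, 2 * s ≤ len j.castSucc) →
    ∀ out, Set.InjOn out (outBox lo len) → ∀ sp,
    NeedsWrites M B ((asymAlg ω op g inp lo len out).trace sp) (vol len / (10 * s * q * B)))
    ?_ ?_ lo len hl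
  · intro lo len h1 _ hlen
    have := hlen ⟨0, hd⟩
    rw [h1] at this
    norm_num at this
    linarith
  · intro lo len i hl hi h ih1 ih2 hlen out hinj sp
    have hB' : (1 : ℝ) ≤ B := by exact_mod_cast hB
    -- Here the recursion is not followed further: the area is at least 2M, so discarding the M / B
    -- lines that may stay dirty loses at most half of area / B.
    by_cases hm : (len (Fin.last d) : ℝ) ≤ 5 * s * q
    · refine (needsWrites_of_card _ hB).mono ?_
      have hA : 2 * (M : ℝ) ≤ area len := by
        calc 2 * (M : ℝ) ≤ 2 ^ d * s ^ d := by
              rw [hsM]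
              gcongr
              simpa using pow_le_pow_right₀ (by norm_num : (1 : ℝ) ≤ 2) hd
          _ = ∏ _j : Fin d, (2 * s) := by simp [mul_pow]
          _ ≤ ∏ j : Fin d, (len j.castSucc : ℝ) :=
              Finset.prod_le_prod (fun _ _ => by positivity) fun j _ => hlen j
          _ = area len := by simp [area]
      have hc : (area len : ℝ) ≤ B * (dstLines B ((asymAlg ω op g inp lo len out).trace sp)).card :=
        mod_cast card_le_mul_card_dstLines (good_trace ω g inp hop lo len hl out sp) hinj hB
      rw [vol_eq, Nat.cast_mul]
      calc (area len : ℝ) * len (Fin.last d) / (10 * s * q * B)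
          ≤ area len * (5 * s * q) / (10 * s * q * B) := by gcongr
        _ = (area len - area len / 2) / B := by field_simp; ring
        _ ≤ (area len - M) / B := by gcongr; linarith
        _ ≤ (B * (dstLines B ((asymAlg ω op g inp lo len out).trace sp)).card - M) / B := by
            gcongr
        _ = _ := by field_simp
    · have hv : (vol len : ℝ) / (10 * s * q * B) = vol (len₁ len i) / (10 * s * q * B)
          + vol (len₂ len i) / (10 * s * q * B) := by
        rw [← vol_halves len i]; push_cast; ring
      rw [hv]
      push Not at hm
      by_cases hil : i = Fin.last d
      · subst hil
        rw [asymAlg_last _ _ _ _ _ _ h]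
        simp only [Prog.trace]
        -- The addition loop is credited with no writes.
        rw [← add_zero (_ / _ + _ / _ : ℝ)]
        refine ((ih1 ?_ _ ?_ _).append (ih2 ?_ _ ?_ _)).append (zero_needsWrites _)
        · simpa using hlen
        · rw [outBox_len₁_last]; exact tempAddr_injOn _ _ _
        · simpa using hlen
        · rw [outBox_len₂_last]; exact tempAddr_injOn _ _ _
      · rw [asymAlg_other _ _ _ _ _ _ h hil]
        obtain ⟨j, rfl⟩ := Fin.exists_castSucc_eq.2 hil
        have hm2 : 2 ≤ len (Fin.last d) := by
          have : (2 : ℝ) < len (Fin.last d) := by nlinarith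
          exact_mod_cast this.le
        have hj := le_mul_dimWeight_of_pickDim h hm2
        rw [hw] at hj
        -- By the selection rule the halved extent is at least the last extent over q. After
        -- rounding, half of 5s is still at least 2s because s ≥ 1.
        have hj5 : 5 * s ≤ len j.castSucc := by
          refine le_trans ?_ hj
          rw [← div_eq_mul_inv, le_div_iff₀ (by linarith)]
          exact hm.le
        have h1 : ∀ a : ℕ, len j.castSucc ≤ 2 * a + 1 → 2 * s ≤ a := fun a ha => by
          have : (len j.castSucc : ℝ) ≤ 2 * a + 1 := by exact_mod_cast ha
          linarith
        refine (ih1 (fun l => ?_) _ ?_ _).append (ih2 (fun l => ?_) _ ?_ _)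
        · by_cases hlj : l = j
          · subst hlj; rw [len₁_self]; exact h1 _ (by omega)
          · rw [len₁_ne (by simpa using hlj)]; exact hlen l
        · exact hinj.mono (Finset.coe_subset.2 (outBox_len₁_subset _ _ _))
        · by_cases hlj : l = j
          · subst hlj; rw [len₂_self]; exact h1 _ (by omega)
          · rw [len₂_ne (by simpa using hlj)]; exact hlen l
        · exact hinj.mono (Finset.coe_subset.2 (outBox_len₂_subset _ _ _))

/-- The number of writes of an execution of the whole grid. -/
theorem le_writes_gridProg (hop : ∀ u v w, op (op u v) w = op u (op v w)) (hd : 1 ≤ d) {s q : ℝ}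
    (hs : 1 ≤ s) (hsM : s ^ d = M) (hB : 1 ≤ B) (hq : 1 ≤ q)
    (hw : dimWeight ω (Fin.last d) = q⁻¹) {n : ℕ} (hn : 1 ≤ n) {r w : ℕ}
    (h : CacheRun M B ∅ ∅ ((gridProg ω op g n).trace (stackBase d n)) r w) :
    (n : ℝ) ^ (d + 1) / (10 * s * q * B) ≤ w := by
  have hB' : (1 : ℝ) ≤ B := by exact_mod_cast hB
  have hinj := (layout_grid (d := d) n 0).injOn
  by_cases hns : 2 * s ≤ n
  · rw [← List.append_nil (Prog.trace _ _)] at h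
    obtain ⟨C', D', r', w', -, -, -, hw'⟩ := needsWrites_trace g (inputAddr n) hop hd hs hsM hB hq
      hw _ _ (fun _ => hn) (fun _ => hns) _ hinj _ h subset_rfl (by simp)
    have hv : (vol (fun _ : Fin (d + 1) => n) : ℝ) = (n : ℝ) ^ (d + 1) := by simp [vol]
    rw [hv] at hw'
    have : (0 : ℝ) ≤ w' := Nat.cast_nonneg _
    linarith
  -- The output may fit in the cache here, but the execution has to end with all its lines written
  -- back, and n < 2s makes n^d / B writes suffice.
  · push Not at hns
    have h1 := h.card_dstLines_le
    rw [Finset.empty_union] at h1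
    have hA := card_le_mul_card_dstLines (good_trace ω g (inputAddr n) hop _ _ (fun _ => hn)
      (outputAddr n) (stackBase d n)) hinj hB
    have hA' : (n : ℝ) ^ d ≤ B * w := by
      have : n ^ d ≤ B * w := by
        simpa [area] using hA.trans (Nat.mul_le_mul_left B h1)
      exact_mod_cast this
    calc (n : ℝ) ^ (d + 1) / (10 * s * q * B) = n ^ d * n / (10 * s * q * B) := by rw [pow_succ]
      _ ≤ B * w * (10 * s * q) / (10 * s * q * B) := by
          gcongr
          nlinarith
      _ = w := by field_simp

end lower

/-! ### Building cache executions -/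

section reach

variable {V : Type*} {M B : ℕ}

/-- With `r` reads and `w` writes, `l` can be executed from the cache contents `C` with dirty lines
`D` so that the cache contents are `C'` with dirty lines `D'` afterwards. -/
def Reach (M B : ℕ) (C D : Finset ℕ) (l : List (Instr V)) (C' D' : Finset ℕ) (r w : ℕ) : Prop :=
  ∀ ⦃rest : List (Instr V)⦄ ⦃r' w' : ℕ⦄, CacheRun M B C' D' rest r' w' →
    CacheRun M B C D (l ++ rest) (r + r') (w + w')

theorem Reach.refl (C D : Finset ℕ) : Reach (V := V) M B C D [] C D 0 0 := by
  intro rest r' w' h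
  simpa using h

theorem Reach.trans {C D C' D' C'' D'' : Finset ℕ} {l₁ l₂ : List (Instr V)} {r₁ r₂ w₁ w₂ : ℕ}
    (h₁ : Reach M B C D l₁ C' D' r₁ w₁) (h₂ : Reach M B C' D' l₂ C'' D'' r₂ w₂) :
    Reach M B C D (l₁ ++ l₂) C'' D'' (r₁ + r₂) (w₁ + w₂) := by
  intro rest r' w' h
  rw [List.append_assoc, add_assoc, add_assoc]
  exact h₁ (h₂ h)

theorem Reach.load (C D X : Finset ℕ) (h : (C ∪ X).card * B ≤ M) :
    Reach (V := V) M B C D [] (C ∪ X) D (X \ C).card 0 := by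
  induction X using Finset.induction_on with
  | empty => simpa using Reach.refl C D
  | insert x X hx ih =>
    have ih := ih (le_trans (Nat.mul_le_mul_right _ (Finset.card_le_card
      (Finset.union_subset_union subset_rfl (Finset.subset_insert _ _)))) h)
    by_cases hxC : x ∈ C
    · rwa [Finset.union_insert, Finset.insert_eq_of_mem (Finset.mem_union_left _ hxC),
        Finset.insert_sdiff_of_mem _ hxC]
    · rw [Finset.union_insert] at h ⊢
      have hx' : x ∉ C ∪ X := by simp [hxC, hx]
      rw [Finset.insert_sdiff_of_notMem _ hxC, Finset.card_insert_of_notMem (by simp [hx])]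
      refine ih.trans (l₂ := []) (r₂ := 1) (w₂ := 0) fun rest r' w' hr => ?_
      rw [add_comm 1, zero_add]
      exact .load x hx' (by rwa [Finset.card_insert_of_notMem hx'] at h) hr

theorem Reach.drop (C D X : Finset ℕ) (h : Disjoint X D) (hX : X ⊆ C) :
    Reach (V := V) M B C D [] (C \ X) D 0 0 := by
  induction X using Finset.induction_on with
  | empty => simpa using Reach.refl C D
  | insert x X hx ih =>
    rw [Finset.disjoint_insert_left] at h
    rw [Finset.insert_subset_iff] at hX
    refine (ih h.2 hX.2).trans (l₂ := []) (r₂ := 0) (w₂ := 0) fun rest r' w' hr => ?_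
    rw [zero_add, zero_add]
    refine .drop x (by simp [hx, hX.1]) h.1 ?_
    rwa [← Finset.sdiff_insert]

theorem Reach.writeBack (C D X : Finset ℕ) (hX : X ⊆ D) :
    Reach (V := V) M B C D [] C (D \ X) 0 X.card := by
  induction X using Finset.induction_on with
  | empty => simpa using Reach.refl C D
  | insert x X hx ih =>
    rw [Finset.insert_subset_iff] at hX
    rw [Finset.card_insert_of_notMem hx]
    refine (ih hX.2).trans (l₂ := []) (r₂ := 0) (w₂ := 1) fun rest r' w' hr => ?_
    rw [zero_add, add_comm 1]
    refine .writeBack x (by simp [hx, hX.1]) ?_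
    rwa [← Finset.sdiff_insert]

theorem Reach.steps (C D : Finset ℕ) {l : List (Instr V)} (h : ∀ i ∈ l, i.lines B ⊆ C) :
    Reach M B C D l C (D ∪ dstLines B l) 0 0 := by
  induction l generalizing D with
  | nil => simpa [dstLines] using Reach.refl C D
  | cons i l ih =>
    intro rest r' w' hr
    rw [dstLines_cons, Finset.union_insert, ← Finset.insert_union] at hr
    exact .step i (h i List.mem_cons_self)
      (ih _ (fun j hj => h j (List.mem_cons_of_mem _ hj)) hr)

/-- While the lines `P` are kept in the cache, the list `l` can be executed with at most `ρ`
reads. -/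
def PinnedReads (M B : ℕ) (P : Finset ℕ) (l : List (Instr V)) (ρ : ℝ) : Prop :=
  ∀ D ⊆ P, ∃ D' ⊆ P, ∃ r : ℕ, (r : ℝ) ≤ ρ ∧ Reach M B P D l P D' r 0

theorem PinnedReads.append {P : Finset ℕ} {l₁ l₂ : List (Instr V)} {ρ₁ ρ₂ : ℝ}
    (h₁ : PinnedReads M B P l₁ ρ₁) (h₂ : PinnedReads M B P l₂ ρ₂) :
    PinnedReads M B P (l₁ ++ l₂) (ρ₁ + ρ₂) := by
  intro D hD
  obtain ⟨D', hD', r₁, hr₁, h₁⟩ := h₁ D hD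
  obtain ⟨D'', hD'', r₂, hr₂, h₂⟩ := h₂ D' hD'
  exact ⟨D'', hD'', r₁ + r₂, by push_cast; linarith, h₁.trans h₂⟩

theorem PinnedReads.mono {P : Finset ℕ} {l : List (Instr V)} {ρ ρ' : ℝ}
    (h : PinnedReads M B P l ρ) (hρ : ρ ≤ ρ') : PinnedReads M B P l ρ' := by
  intro D hD
  obtain ⟨D', hD', r, hr, h⟩ := h D hD
  exact ⟨D', hD', r, hr.trans hρ, h⟩

/-- Load `X`, execute, and drop `X \ P`. The dropped lines are clean because all modified lines are
in `P`, so nothing is written back. -/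
theorem pinnedReads_card {P X : Finset ℕ} {l : List (Instr V)} (hPX : (P ∪ X).card * B ≤ M)
    (h : ∀ i ∈ l, i.lines B ⊆ P ∪ X) (hdst : ∀ i ∈ l, i.dst / B ∈ P) :
    PinnedReads M B P l X.card := by
  intro D hD
  have hD' : D ∪ dstLines B l ⊆ P := Finset.union_subset hD fun b hb => by
    obtain ⟨i, hi, rfl⟩ := List.mem_map.1 (List.mem_toFinset.1 hb)
    exact hdst i hi
  have h3 := Reach.drop (V := V) (M := M) (B := B) (P ∪ X) (D ∪ dstLines B l) (X \ P)
    (Finset.disjoint_of_subset_right hD' Finset.sdiff_disjoint)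
    (Finset.sdiff_subset.trans Finset.subset_union_right)
  have hP : (P ∪ X) \ (X \ P) = P := by ext; simp; tauto
  rw [hP] at h3
  refine ⟨_, hD', (X \ P).card, by exact_mod_cast Finset.card_le_card Finset.sdiff_subset, ?_⟩
  simpa using ((Reach.load P D X hPX).trans (Reach.steps _ D h)).trans h3

/-- The list `l` can be executed at cost `q`, starting and ending with an empty cache. -/
def FreshCost (M B : ℕ) (ω : ℝ) (l : List (Instr V)) (q : ℝ) : Prop :=
  ∃ r w : ℕ, (r : ℝ) + ω * w ≤ q ∧ Reach M B ∅ ∅ l ∅ ∅ r w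

variable {ω : ℝ}

theorem FreshCost.append {l₁ l₂ : List (Instr V)} {q₁ q₂ : ℝ} (h₁ : FreshCost M B ω l₁ q₁)
    (h₂ : FreshCost M B ω l₂ q₂) : FreshCost M B ω (l₁ ++ l₂) (q₁ + q₂) := by
  obtain ⟨r₁, w₁, hq₁, h₁⟩ := h₁
  obtain ⟨r₂, w₂, hq₂, h₂⟩ := h₂
  exact ⟨r₁ + r₂, w₁ + w₂, by push_cast; linarith, h₁.trans h₂⟩

theorem FreshCost.mono {l : List (Instr V)} {q q' : ℝ} (h : FreshCost M B ω l q) (hq : q ≤ q') :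
    FreshCost M B ω l q' := by
  obtain ⟨r, w, hr, h⟩ := h
  exact ⟨r, w, hr.trans hq, h⟩

theorem freshCost_nil : FreshCost (V := V) M B ω [] 0 := ⟨0, 0, by simp, .refl _ _⟩

/-- Load `P` at the beginning; write back its dirty lines and empty the cache at the end. -/
theorem PinnedReads.freshCost {P : Finset ℕ} {l : List (Instr V)} {ρ : ℝ}
    (h : PinnedReads M B P l ρ) (hP : P.card * B ≤ M) (hω : 0 ≤ ω) :
    FreshCost M B ω l (ρ + P.card * (1 + ω)) := by
  obtain ⟨D, hD, r, hr, h⟩ := h ∅ (Finset.empty_subset P)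
  have h1 := Reach.load (V := V) (M := M) (B := B) ∅ ∅ P (by simpa using hP)
  have h3 := Reach.writeBack (V := V) (M := M) (B := B) P D D subset_rfl
  have h4 := Reach.drop (V := V) (M := M) (B := B) P ∅ P (by simp) subset_rfl
  simp only [Finset.empty_union, Finset.sdiff_empty] at h1
  rw [Finset.sdiff_self] at h3 h4
  refine ⟨P.card + r, D.card, ?_, by simpa using ((h1.trans h).trans h3).trans h4⟩
  have : (D.card : ℝ) ≤ P.card := by exact_mod_cast Finset.card_le_card hD
  push_cast
  nlinarith

theorem FreshCost.asymCacheComplexity_le {l : List (Instr V)} {q : ℝ}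
    (h : FreshCost M B ω l q) : asymCacheComplexity M B ω l ≤ ENNReal.ofReal q := by
  obtain ⟨r, w, hq, h⟩ := h
  have := h (CacheRun.done ∅)
  simp only [List.append_nil, add_zero] at this
  exact (iInf_le_of_le r <| iInf_le_of_le w <| iInf_le _ this).trans (ENNReal.ofReal_le_ofReal hq)

end reach

/-! ### Counting lines -/

section lines

/-- The lines of the consecutive addresses `a, …, a + n - 1`. -/
def intervalLines (B a n : ℕ) : Finset ℕ := (Finset.Ico a (a + n)).image (· / B)

theorem card_intervalLines_le {B : ℕ} (hB : 1 ≤ B) (a n : ℕ) :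
    (intervalLines B a n).card ≤ n / B + 2 := by
  rcases Nat.eq_zero_or_pos n with rfl | hn
  · simp [intervalLines]
  have h : intervalLines B a n ⊆ Finset.Icc (a / B) (a / B + n / B + 1) := by
    intro b hb
    obtain ⟨c, hc, rfl⟩ := Finset.mem_image.1 hb
    rw [Finset.mem_Ico] at hc
    refine Finset.mem_Icc.2 ⟨Nat.div_le_div_right hc.1, ?_⟩
    refine Nat.le_of_lt_succ ((Nat.div_lt_iff_lt_mul hB).2 ?_)
    have h1 := Nat.lt_div_mul_add hB (a := a)
    have h2 := Nat.lt_div_mul_add hB (a := n)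
    have h3 : (a / B + n / B + 1).succ * B = a / B * B + n / B * B + B + B := by
      simp only [Nat.succ_eq_add_one]; ring
    omega
  refine (Finset.card_le_card h).trans ?_
  simp
  omega

variable {e : ℕ}

/-- The rows of the array with address function `f` are contiguous on a box. -/
def RowContiguous (f : (Fin (e + 1) → ℕ) → ℕ) (a n : Fin (e + 1) → ℕ) : Prop :=
  ∀ y ∈ box a n, ∀ z ∈ box a n, (∀ j : Fin e, y j.castSucc = z j.castSucc) →
    y (Fin.last e) ≤ z (Fin.last e) → f z = f y + (z (Fin.last e) - y (Fin.last e))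

theorem RowContiguous.mono {f : (Fin (e + 1) → ℕ) → ℕ} {a n a' n' : Fin (e + 1) → ℕ}
    (h : RowContiguous f a n) (hb : box a' n' ⊆ box a n) : RowContiguous f a' n' :=
  fun y hy z hz => h y (hb hy) z (hb hz)

/-- The lines of the entries of a box in the array with address function `f`. -/
def boxLines (B : ℕ) (f : (Fin (e + 1) → ℕ) → ℕ) (a n : Fin (e + 1) → ℕ) : Finset ℕ :=
  (box a n).image fun y => f y / B

/-- The box is a union of rows, each of which is an interval of addresses; the 2 accounts for
rounding and alignment. -/
theorem card_boxLines_le {B : ℕ} (hB : 1 ≤ B) {f : (Fin (e + 1) → ℕ) → ℕ}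
    {a n : Fin (e + 1) → ℕ} (h : RowContiguous f a n) :
    (boxLines B f a n).card ≤ (∏ j : Fin e, n j.castSucc) * (n (Fin.last e) / B + 2) := by
  have hsub : boxLines B f a n ⊆ (box (fun j => a j.castSucc) fun j => n j.castSucc).biUnion
      fun z => intervalLines B (f (Fin.snoc (α := fun _ => ℕ) z (a (Fin.last e))))
        (n (Fin.last e)) := by
    intro b hb
    obtain ⟨y, hy, rfl⟩ := Finset.mem_image.1 hb
    have hy' := mem_box.1 hy
    have hl := hy' (Fin.last e)
    refine Finset.mem_biUnion.2 ⟨fun j => y j.castSucc, mem_box.2 fun j => hy' j.castSucc,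
      Finset.mem_image.2 ⟨f y, ?_, rfl⟩⟩
    rw [h (Fin.snoc (α := fun _ => ℕ) (fun j => y j.castSucc) (a (Fin.last e))) ?_ y hy
      (fun j => by simp) (by simpa using hl.1)]
    · simp only [Fin.snoc_last, Finset.mem_Ico]
      omega
    · refine mem_box.2 fun i => ?_
      rcases Fin.eq_castSucc_or_eq_last i with ⟨j, rfl⟩ | rfl
      · simpa using hy' j.castSucc
      · simp; omega
  refine (Finset.card_le_card hsub).trans (Finset.card_biUnion_le.trans ?_)
  refine (Finset.sum_le_card_nsmul _ _ (n (Fin.last e) / B + 2) fun z _ =>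
    card_intervalLines_le hB _ _).trans ?_
  rw [card_box, smul_eq_mul]

theorem rowContiguous_rowMajor {s : Fin (e + 1) → ℕ} {y z : Fin (e + 1) → ℕ}
    (h : ∀ j : Fin e, y j.castSucc = z j.castSucc) (hl : y (Fin.last e) ≤ z (Fin.last e)) :
    rowMajor s z = rowMajor s y + (z (Fin.last e) - y (Fin.last e)) := by
  have hI : Finset.Ioi (Fin.last e) = ∅ := by ext i; simp [Fin.le_last]
  simp only [rowMajor, Fin.sum_univ_castSucc, h, hI, Finset.prod_empty]
  omega

theorem rowContiguous_tempAddr (ta : ℕ) (lo len : Fin (e + 2) → ℕ) :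
    RowContiguous (tempAddr ta lo len) (fun j => lo j.castSucc) (fun j => len j.castSucc) := by
  intro y hy z hz h hl
  have h1 := mem_box.1 hy (Fin.last e)
  simp only [tempAddr]
  rw [rowContiguous_rowMajor (y := fun j => y j - lo j.castSucc)
    (z := fun j => z j - lo j.castSucc) (fun j => by simp [h]) (by omega)]
  omega

theorem rowContiguous_inputAddr (n : ℕ) (j : Fin (e + 1)) (a m : Fin (e + 1) → ℕ) :
    RowContiguous (inputAddr n j) a m := by
  intro y _ z _ h hl
  simp only [inputAddr]
  rw [rowContiguous_rowMajor h hl, add_assoc]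

theorem rowContiguous_outputAddr (n : ℕ) (a m : Fin (e + 1) → ℕ) :
    RowContiguous (outputAddr n) a m := by
  intro y _ z _ h hl
  simp only [outputAddr]
  rw [rowContiguous_rowMajor h hl, add_assoc]

end lines

/-! ### The cost of adding two temporary arrays -/

section addLoop

variable {V : Type*} {M B e : ℕ} {ω : ℝ} {op : V → V → V} {lo len : Fin (e + 2) → ℕ}
  {out : (Fin (e + 1) → ℕ) → ℕ}

/-- The stride of a coordinate other than the last has the last extent as a factor, so the
coordinate depends only on the number of the row. -/
theorem rowMajorIndex_castSucc_eq {s : Fin (e + 1) → ℕ} {t u : ℕ}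
    (h : t / s (Fin.last e) = u / s (Fin.last e)) (j : Fin e) :
    rowMajorIndex s t j.castSucc = rowMajorIndex s u j.castSucc := by
  have hj : Fin.last e ∈ Finset.Ioi j.castSucc := Finset.mem_Ioi.2 (Fin.castSucc_lt_last j)
  simp only [rowMajorIndex]
  rw [← Finset.mul_prod_erase _ _ hj, ← Nat.div_div_eq_div_mul, h, Nat.div_div_eq_div_mul]

theorem rowMajorIndex_last (s : Fin (e + 1) → ℕ) (t : ℕ) :
    rowMajorIndex s t (Fin.last e) = t % s (Fin.last e) := by
  have hI : Finset.Ioi (Fin.last e) = ∅ := by ext i; simp [Fin.le_last]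
  simp [rowMajorIndex, hI]

theorem RowContiguous.outIndex
    (h : RowContiguous out (fun j => lo j.castSucc) (fun j => len j.castSucc))
    (hl : ∀ j, 1 ≤ len j) {t u : ℕ} (htu : t ≤ u)
    (hdiv : t / len (Fin.last e).castSucc = u / len (Fin.last e).castSucc) :
    out (outIndex lo len u) = out (outIndex lo len t) + (u - t) := by
  have ht := Nat.div_add_mod t (len (Fin.last e).castSucc)
  have hu := Nat.div_add_mod u (len (Fin.last e).castSucc)
  rw [hdiv] at ht
  have hj : ∀ j : Fin e, KDGrid.outIndex lo len t j.castSucc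
      = KDGrid.outIndex lo len u j.castSucc := fun j => congrArg (lo j.castSucc.castSucc + ·)
    (rowMajorIndex_castSucc_eq (s := fun j => len j.castSucc) hdiv j)
  have ht' : KDGrid.outIndex lo len t (Fin.last e)
      = lo (Fin.last e).castSucc + t % len (Fin.last e).castSucc :=
    congrArg (lo (Fin.last e).castSucc + ·) (rowMajorIndex_last _ t)
  have hu' : KDGrid.outIndex lo len u (Fin.last e)
      = lo (Fin.last e).castSucc + u % len (Fin.last e).castSucc :=
    congrArg (lo (Fin.last e).castSucc + ·) (rowMajorIndex_last _ u)
  rw [h _ (outIndex_mem hl t) _ (outIndex_mem hl u) hj (by omega)]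
  omega

/-- Within one row, at most `B` consecutive positions touch three intervals of at most 3 lines each.
Loading these 9 lines and writing them back costs at most 9(1 + ω) ≤ 18ω. -/
theorem freshCost_addInstr_chunk (hω : 1 ≤ ω) (hB : 1 ≤ B) (hM : 9 * B ≤ M)
    (h : RowContiguous out (fun j => lo j.castSucc) (fun j => len j.castSucc))
    (hl : ∀ j, 1 ≤ len j) (ta tb : ℕ) {a n : ℕ} (hn : n ≤ B)
    (hrow : ∀ t, a ≤ t → t < a + n →
      a / len (Fin.last e).castSucc = t / len (Fin.last e).castSucc) :
    FreshCost M B ω ((List.range' a n).map (addInstr op lo len out ta tb)) (18 * ω) := by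
  set P := intervalLines B (out (outIndex lo len a)) n ∪
    (intervalLines B (ta + a) n ∪ intervalLines B (tb + a) n)
  have hP : P.card ≤ 9 := by
    have hnB : n / B ≤ 1 := (Nat.div_le_div_right hn).trans (Nat.div_self hB).le
    have h1 := card_intervalLines_le hB (out (outIndex lo len a)) n
    have h2 := card_intervalLines_le hB (ta + a) n
    have h3 := card_intervalLines_le hB (tb + a) n
    have h4 : P.card ≤ _ := Finset.card_union_le (intervalLines B (out (outIndex lo len a)) n)
      (intervalLines B (ta + a) n ∪ intervalLines B (tb + a) n)
    have h5 := Finset.card_union_le (intervalLines B (ta + a) n) (intervalLines B (tb + a) n)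
    omega
  have hPM : P.card * B ≤ M := (Nat.mul_le_mul_right B hP).trans hM
  have hmem : ∀ i ∈ (List.range' a n).map (addInstr op lo len out ta tb), ∃ t, a ≤ t ∧ t < a + n ∧
      addInstr op lo len out ta tb t = i := fun i hi => by
    obtain ⟨t, ht, rfl⟩ := List.mem_map.1 hi
    rw [List.mem_range'_1] at ht
    exact ⟨t, ht.1, ht.2, rfl⟩
  have hdst : ∀ i ∈ (List.range' a n).map (addInstr op lo len out ta tb), i.dst / B ∈ P := by
    intro i hi
    obtain ⟨t, h1, h2, rfl⟩ := hmem i hi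
    refine Finset.mem_union_left _ (Finset.mem_image_of_mem _ ?_)
    change out (outIndex lo len t) ∈ _
    rw [h.outIndex hl h1 (hrow t h1 h2), Finset.mem_Ico]
    omega
  have hpin : PinnedReads M B P ((List.range' a n).map (addInstr op lo len out ta tb))
      (∅ : Finset ℕ).card := by
    refine pinnedReads_card (by simpa using hPM) (fun i hi => ?_) hdst
    rw [Finset.union_empty, Instr.lines, Finset.insert_subset_iff]
    refine ⟨hdst i hi, ?_⟩
    obtain ⟨t, h1, h2, rfl⟩ := hmem i hi
    intro b hb
    obtain ⟨v, -, rfl⟩ := Finset.mem_image.1 hb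
    refine Finset.mem_union_right _ ?_
    change Fin 2 at v
    fin_cases v
    · exact Finset.mem_union_left _ (Finset.mem_image_of_mem (· / B)
        (Finset.mem_Ico.2 ⟨Nat.add_le_add_left h1 ta, by
          change ta + t < _
          omega⟩))
    · exact Finset.mem_union_right _ (Finset.mem_image_of_mem (· / B)
        (Finset.mem_Ico.2 ⟨Nat.add_le_add_left h1 tb, by
          change tb + t < _
          omega⟩))
  refine (hpin.freshCost hPM (by linarith)).mono ?_
  have hP' : (P.card : ℝ) ≤ 9 := by exact_mod_cast hP
  simp only [Finset.card_empty, Nat.cast_zero]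
  nlinarith

theorem freshCost_addInstr_row (hω : 1 ≤ ω) (hB : 1 ≤ B) (hM : 9 * B ≤ M)
    (h : RowContiguous out (fun j => lo j.castSucc) (fun j => len j.castSucc))
    (hl : ∀ j, 1 ≤ len j) (ta tb : ℕ) (a n : ℕ)
    (hrow : ∀ t, a ≤ t → t < a + n →
      a / len (Fin.last e).castSucc = t / len (Fin.last e).castSucc) :
    FreshCost M B ω ((List.range' a n).map (addInstr op lo len out ta tb))
      (18 * ω * (n / B + 1)) := by
  induction n using Nat.strong_induction_on generalizing a with
  | _ n ih =>
    have hB' : (1 : ℝ) ≤ B := by exact_mod_cast hB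
    by_cases hn : n ≤ B
    · refine (freshCost_addInstr_chunk hω hB hM h hl ta tb hn hrow).mono ?_
      have : (0 : ℝ) ≤ n / B := by positivity
      nlinarith
    · push Not at hn
      have h1 := freshCost_addInstr_chunk (op := op) hω hB hM h hl ta tb le_rfl
        fun t h1 h2 => hrow t h1 (by omega)
      have h2 := ih (n - B) (by omega) (a + B) fun t h1 h2 =>
        (hrow (a + B) (by omega) (by omega)).symm.trans (hrow t (by omega) (by omega))
      have h3 := h1.append h2
      rw [← List.map_append, List.range'_append_1, Nat.add_sub_cancel' hn.le,
        Nat.cast_sub hn.le] at h3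
      refine h3.mono (le_of_eq ?_)
      field_simp
      ring

/-- The array is processed row by row. A row has at least `B` entries, so the rounding term of its
cost is at most its main term. -/
theorem freshCost_addInstr (hω : 1 ≤ ω) (hB : 1 ≤ B) (hM : 9 * B ≤ M)
    (h : RowContiguous out (fun j => lo j.castSucc) (fun j => len j.castSucc))
    (hl : ∀ j, 1 ≤ len j) (ta tb : ℕ) (hlen : B ≤ len (Fin.last e).castSucc) :
    FreshCost M B ω ((List.range' 0 (area len)).map (addInstr op lo len out ta tb))
      (36 * ω * area len / B) := by
  have hB' : (1 : ℝ) ≤ B := by exact_mod_cast hB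
  set L := len (Fin.last e).castSucc with hL
  have hL0 : 0 < L := by omega
  have key : ∀ R : ℕ, FreshCost M B ω
      ((List.range' 0 (R * L)).map (addInstr op lo len out ta tb)) (R * (36 * ω * L / B)) := by
    intro R
    induction R with
    | zero => simpa using freshCost_nil
    | succ R ih =>
      have h1 := ih.append (freshCost_addInstr_row (op := op) hω hB hM h hl ta tb (R * L) L
        fun t ht ht' => by
          rw [← hL, Nat.mul_div_cancel _ hL0]
          exact ((Nat.div_eq_iff hL0).2 ⟨ht, by omega⟩).symm)
      have h2 : List.range' (R * L) L = List.range' (0 + R * L) L := by rw [zero_add]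
      rw [← List.map_append, h2, List.range'_append_1, ← Nat.succ_mul] at h1
      refine h1.mono ?_
      have hLB : (1 : ℝ) ≤ L / B := by
        rw [le_div_iff₀ (by linarith), one_mul]; exact_mod_cast hlen
      have : 18 * ω * (L / B + 1) ≤ 36 * ω * L / B := by
        rw [mul_div_assoc]; nlinarith
      push_cast
      linarith
  have := key (∏ j : Fin e, len j.castSucc.castSucc)
  have hA : area len = (∏ j : Fin e, len j.castSucc.castSucc) * L := Fin.prod_univ_castSucc _
  rw [← hA] at this
  refine this.mono (le_of_eq ?_)
  rw [hA]
  push_cast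
  ring

end addLoop

/-! ### Stack space, and the shape of the boxes of the recursion -/

section space

variable {V : Type*} {d : ℕ} {ω : ℝ} (op : V → V → V) (g : (Fin (d + 1) → ℕ) → (Fin d → V) → V)
  (inp : Fin d → (Fin d → ℕ) → ℕ)

/-- Space is used only when the last dimension, of extent m, is split. The others are then at most
max(1, m/q), so the two arrays have at most 2 + 2(m/q)^d words. The second part sums geometrically;
the constant part occurs once per halving of m, whence the logarithm. -/
theorem seqSpace_le (hd : 1 ≤ d) {q : ℝ} (hq : 1 ≤ q) (hw : dimWeight ω (Fin.last d) = q⁻¹)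
    (lo len : Fin (d + 1) → ℕ) (hl : ∀ j, 1 ≤ len j) (out : (Fin d → ℕ) → ℕ) (sp : ℕ) :
    ((asymAlg ω op g inp lo len out).seqSpace sp : ℝ)
      ≤ 6 * (len (Fin.last d) / q) ^ d + 2 * Nat.clog 2 (len (Fin.last d)) := by
  revert out sp
  refine box_induction ω (motive := fun lo len => ∀ out sp,
    ((asymAlg ω op g inp lo len out).seqSpace sp : ℝ)
      ≤ 6 * (len (Fin.last d) / q) ^ d + 2 * Nat.clog 2 (len (Fin.last d))) ?_ ?_ lo len hl
  · intro lo len h1 h out sp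
    rw [asymAlg_none _ _ _ _ _ _ h]
    simp only [Prog.seqSpace, Nat.cast_zero]
    positivity
  · intro lo len i hl hi h ih1 ih2 out sp
    by_cases hil : i = Fin.last d
    · subst hil
      rw [asymAlg_last _ _ _ _ _ _ h]
      simp only [Prog.seqSpace, Prog.seqSpace_parFor_instr]
      have h1 := ih1 (tempAddr sp lo len) (sp + area len + area len)
      have h2 := ih2 (tempAddr (sp + area len) lo len) (sp + area len + area len)
      rw [len₁_self] at h1
      rw [len₂_self] at h2
      have hA : (area len : ℝ) ≤ 1 + (len (Fin.last d) / q) ^ d := by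
        calc (area len : ℝ) = ∏ j : Fin d, (len j.castSucc : ℝ) := by simp [area]
          _ ≤ ∏ _j : Fin d, max 1 ((len (Fin.last d) : ℝ) / q) := by
              refine Finset.prod_le_prod (fun _ _ => by positivity) fun j _ => ?_
              by_cases hj : 2 ≤ len j.castSucc
              · have := le_of_pickDim h hj
                rw [dimWeight_castSucc, hw, mul_one, ← div_eq_mul_inv] at this
                exact le_max_of_le_right this
              · have : len j.castSucc ≤ 1 := by omega
                exact le_max_of_le_left (by exact_mod_cast this)
          _ = (max 1 ((len (Fin.last d) : ℝ) / q)) ^ d := by simp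
          _ ≤ _ := by
              rcases max_cases (1 : ℝ) ((len (Fin.last d) : ℝ) / q) with h | h
              · rw [h.1, one_pow]; exact le_add_of_nonneg_right (by positivity)
              · rw [h.1]; linarith
      obtain ⟨hc1, hc2⟩ := clog_div_two_lt hi
      -- Both halves of an extent m ≥ 2 are at most 2m/3. The factor 6 solves 6 · (2/3) + 2 = 6.
      have key : ∀ a : ℕ, 3 * a ≤ 2 * len (Fin.last d) →
          Nat.clog 2 a + 1 ≤ Nat.clog 2 (len (Fin.last d)) →
          6 * ((a : ℝ) / q) ^ d + 2 * Nat.clog 2 a + 2 * area len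
            ≤ 6 * (len (Fin.last d) / q) ^ d + 2 * Nat.clog 2 (len (Fin.last d)) := by
        intro a ha hca
        have ha' : (a : ℝ) / q ≤ 2 / 3 * (len (Fin.last d) / q) := by
          rw [← mul_div_assoc]
          gcongr
          have : (3 : ℝ) * a ≤ 2 * len (Fin.last d) := by exact_mod_cast ha
          linarith
        have hp : ((a : ℝ) / q) ^ d ≤ 2 / 3 * (len (Fin.last d) / q) ^ d := by
          refine (pow_le_pow_left₀ (by positivity) ha' d).trans ?_
          rw [mul_pow]
          gcongr
          simpa using pow_le_pow_of_le_one (by norm_num : (0 : ℝ) ≤ 2 / 3) (by norm_num) hd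
        have hca' : (Nat.clog 2 a : ℝ) + 1 ≤ Nat.clog 2 (len (Fin.last d)) := by
          exact_mod_cast hca
        linarith
      have k1 := key _ (by omega) hc1
      have k2 := key (len (Fin.last d) - len (Fin.last d) / 2) (by omega) hc2.le
      push_cast
      rw [max_eq_left (by positivity)]
      rcases max_choice
        (((asymAlg ω op g inp lo (len₁ len (Fin.last d)) (tempAddr sp lo len)).seqSpace
          (sp + area len + area len) : ℕ) : ℝ)
        (((asymAlg ω op g inp (lo₂ lo len (Fin.last d)) (len₂ len (Fin.last d))
          (tempAddr (sp + area len) lo len)).seqSpace (sp + area len + area len) : ℕ) : ℝ)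
        with hm | hm
      · rw [hm]; linarith
      · rw [hm]; linarith
    · rw [asymAlg_other _ _ _ _ _ _ h hil]
      have h1 := ih1 out sp
      have h2 := ih2 out sp
      rw [len₁_ne (Ne.symm hil)] at h1
      rw [len₂_ne (Ne.symm hil)] at h2
      simp only [Prog.seqSpace, Nat.cast_max]
      exact max_le h1 h2

/-- The extents of a box are at most `σ`, and at most `μ` in the last dimension. -/
def IsSmall (σ μ : ℝ) (len : Fin (d + 1) → ℕ) : Prop :=
  (∀ j : Fin d, (len j.castSucc : ℝ) ≤ σ) ∧ (len (Fin.last d) : ℝ) ≤ μ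

/-- The extents of a box are at least `σ / 3`, and at least `μ / 3` in the last dimension. -/
def IsLarge (σ μ : ℝ) (len : Fin (d + 1) → ℕ) : Prop :=
  (∀ j : Fin d, σ ≤ 3 * (len j.castSucc : ℝ)) ∧ μ ≤ 3 * (len (Fin.last d) : ℝ)

/-- The recursion passes through boxes of extents about `σ`, and `μ` in the last dimension. -/
structure IsScale (ω σ μ : ℝ) (d : ℕ) : Prop where
  one_le_σ : 1 ≤ σ
  one_le_μ : 1 ≤ μ
  weight_nonneg : 0 ≤ dimWeight ω (Fin.last d)
  le : μ * dimWeight ω (Fin.last d) ≤ σ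
  ge : σ = 1 ∨ σ ≤ μ * dimWeight ω (Fin.last d)

variable {σ μ : ℝ} {len : Fin (d + 1) → ℕ} {i : Fin (d + 1)}

/-- At the target extents the weighted sizes balance, so a dimension within its target is not
preferred to one beyond its target. This uses the inequality `le`; the companion for the other
dimensions uses `ge`, where σ = 1 is harmless because only extents of at least 2 are halved. -/
theorem IsScale.lt_of_pickDim_last (hs : IsScale ω σ μ d) (h : pickDim ω len = some (Fin.last d))
    (hn : ¬ IsSmall σ μ len) : μ < len (Fin.last d) := by
  by_contra hm
  push Not at hm
  refine hn ⟨fun j => ?_, hm⟩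
  by_contra hj
  push Not at hj
  have h2 : 2 ≤ len j.castSucc := by
    have : (1 : ℝ) < len j.castSucc := hs.one_le_σ.trans_lt hj
    exact_mod_cast this
  have := le_of_pickDim h h2
  rw [dimWeight_castSucc, mul_one] at this
  have h3 := mul_le_mul_of_nonneg_right hm hs.weight_nonneg
  have := hs.le
  linarith

theorem IsScale.lt_of_pickDim_castSucc (hs : IsScale ω σ μ d) {j : Fin d}
    (h : pickDim ω len = some j.castSucc) (hn : ¬ IsSmall σ μ len) : σ < len j.castSucc := by
  by_contra hj
  push Not at hj
  refine hn ⟨fun l => ?_, ?_⟩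
  · by_contra hl
    push Not at hl
    have h2 : 2 ≤ len l.castSucc := by
      have : (1 : ℝ) < len l.castSucc := hs.one_le_σ.trans_lt hl
      exact_mod_cast this
    have := le_of_pickDim h h2
    rw [dimWeight_castSucc, dimWeight_castSucc, mul_one, mul_one] at this
    linarith
  · by_contra hm
    push Not at hm
    have h2 : 2 ≤ len (Fin.last d) := by
      have : (1 : ℝ) < len (Fin.last d) := hs.one_le_μ.trans_lt hm
      exact_mod_cast this
    have h3 := le_mul_dimWeight_of_pickDim h h2
    have h4 : (2 : ℝ) ≤ len j.castSucc := by exact_mod_cast two_le_of_pickDim h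
    rcases hs.ge with h1 | h1
    · linarith
    · have hw : 0 < dimWeight ω (Fin.last d) := by
        refine hs.weight_nonneg.lt_of_ne fun e => ?_
        rw [← e, mul_zero] at h1
        linarith [hs.one_le_σ]
      have := mul_lt_mul_of_pos_right hm hw
      linarith

/-- The halved extent exceeds its target, and each half of an extent m ≥ 2 is at least m/3. -/
theorem IsLarge.halves (hs : IsScale ω σ μ d) (h : pickDim ω len = some i)
    (hn : ¬ IsSmall σ μ len) (hl : IsLarge σ μ len) :
    IsLarge σ μ (len₁ len i) ∧ IsLarge σ μ (len₂ len i) := by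
  have hi := two_le_of_pickDim h
  have c1 : (len i : ℝ) ≤ 3 * ((len i / 2 : ℕ) : ℝ) := by
    exact_mod_cast (by omega : len i ≤ 3 * (len i / 2))
  have c2 : (len i : ℝ) ≤ 3 * ((len i - len i / 2 : ℕ) : ℝ) := by
    exact_mod_cast (by omega : len i ≤ 3 * (len i - len i / 2))
  rcases Fin.eq_castSucc_or_eq_last i with ⟨j, rfl⟩ | rfl
  · have hj := hs.lt_of_pickDim_castSucc h hn
    refine ⟨⟨fun l => ?_, ?_⟩, fun l => ?_, ?_⟩
    · by_cases hlj : l = j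
      · subst hlj; rw [len₁_self]; linarith
      · rw [len₁_ne (by simpa using hlj)]; exact hl.1 l
    · rw [len₁_ne (Fin.castSucc_lt_last j).ne']; exact hl.2
    · by_cases hlj : l = j
      · subst hlj; rw [len₂_self]; linarith
      · rw [len₂_ne (by simpa using hlj)]; exact hl.1 l
    · rw [len₂_ne (Fin.castSucc_lt_last j).ne']; exact hl.2
  · have hm := hs.lt_of_pickDim_last h hn
    refine ⟨⟨fun l => ?_, ?_⟩, fun l => ?_, ?_⟩
    · rw [len₁_last_castSucc]; exact hl.1 l
    · rw [len₁_self]; linarith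
    · rw [len₂_last_castSucc]; exact hl.1 l
    · rw [len₂_self]; linarith

theorem IsLarge.le_vol (hσ : 0 ≤ σ) (hμ : 0 ≤ μ) (h : IsLarge σ μ len) :
    σ ^ d * μ ≤ 3 ^ (d + 1) * vol len := by
  calc σ ^ d * μ = (∏ _j : Fin d, σ) * μ := by simp
    _ ≤ (∏ j : Fin d, 3 * (len j.castSucc : ℝ)) * (3 * len (Fin.last d)) :=
        mul_le_mul (Finset.prod_le_prod (fun _ _ => hσ) fun j _ => h.1 j) h.2 hμ
          (Finset.prod_nonneg fun _ _ => by positivity)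
    _ = 3 ^ (d + 1) * vol len := by
        rw [vol_eq, area, Finset.prod_mul_distrib]
        push_cast
        simp
        ring

theorem IsSmall.area_le (h : IsSmall σ μ len) : (area len : ℝ) ≤ σ ^ d := by
  calc (area len : ℝ) = ∏ j : Fin d, (len j.castSucc : ℝ) := by simp [area]
    _ ≤ ∏ _j : Fin d, σ := Finset.prod_le_prod (fun _ _ => by positivity) fun j _ => h.1 j
    _ = σ ^ d := by simp

end space

/-! ### Upper bound for the cache complexity -/

section upper

variable {V : Type*} {M B e : ℕ} {ω : ℝ} {op : V → V → V}
  (g : (Fin (e + 2) → ℕ) → (Fin (e + 1) → V) → V) (inp : Fin (e + 1) → (Fin (e + 1) → ℕ) → ℕ)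

theorem pinnedReads_of_mem {P X : Finset ℕ} {l : List (Instr V)} (hPX : (P ∪ X).card * B ≤ M)
    (hdst : ∀ i ∈ l, i.dst / B ∈ P) (hsrc : ∀ i ∈ l, ∀ t, i.src t / B ∈ P ∪ X) :
    PinnedReads M B P l X.card := by
  refine pinnedReads_card hPX (fun i hi => ?_) hdst
  rw [Instr.lines, Finset.insert_subset_iff]
  refine ⟨Finset.mem_union_left _ (hdst i hi), fun b hb => ?_⟩
  obtain ⟨t, -, rfl⟩ := Finset.mem_image.1 hb
  exact hsrc i hi t

/-- The lines of the input entries of the cells of a box. -/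
def inpLines (B : ℕ) (inp : Fin (e + 1) → (Fin (e + 1) → ℕ) → ℕ) (lo len : Fin (e + 2) → ℕ) :
    Finset ℕ :=
  Finset.univ.biUnion fun j =>
    boxLines B (inp j) (j.castSucc.removeNth lo) (j.castSucc.removeNth len)

theorem div_mem_inpLines {lo len : Fin (e + 2) → ℕ} {a : ℕ} (h : a ∈ inpSet inp lo len) :
    a / B ∈ inpLines B inp lo len := by
  obtain ⟨j, x, hx, rfl⟩ := h
  rw [mem_box] at hx
  exact Finset.mem_biUnion.2 ⟨j, Finset.mem_univ _,
    Finset.mem_image.2 ⟨_, mem_box.2 fun i => hx _, rfl⟩⟩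

theorem card_rows_le {σ μ : ℝ} (hB : 1 ≤ B) {n : Fin (e + 1) → ℕ}
    (h : ∀ j : Fin e, (n j.castSucc : ℝ) ≤ σ) (hl : (n (Fin.last e) : ℝ) ≤ μ) :
    (((∏ j : Fin e, n j.castSucc) * (n (Fin.last e) / B + 2) : ℕ) : ℝ)
      ≤ σ ^ e * (μ / B + 2) := by
  have h1 : ∏ j : Fin e, (n j.castSucc : ℝ) ≤ σ ^ e := by
    calc ∏ j : Fin e, (n j.castSucc : ℝ) ≤ ∏ _j : Fin e, σ :=
          Finset.prod_le_prod (fun _ _ => by positivity) fun j _ => h j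
      _ = σ ^ e := by simp
  have h2 : ((n (Fin.last e) / B : ℕ) : ℝ) ≤ μ / B :=
    Nat.cast_div_le.trans (by gcongr)
  push_cast
  have h3 : (0 : ℝ) ≤ ∏ j : Fin e, (n j.castSucc : ℝ) :=
    Finset.prod_nonneg fun _ _ => by positivity
  exact mul_le_mul h1 (by linarith) (by positivity) (h3.trans h1)

theorem card_inpLines_le {σ μ : ℝ} (hB : 1 ≤ B) (hinp : ∀ j a m, RowContiguous (inp j) a m)
    {lo len : Fin (e + 2) → ℕ} (h : IsSmall σ μ len) :
    ((inpLines B inp lo len).card : ℝ) ≤ (e + 1) * (σ ^ e * (μ / B + 2)) := by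
  -- The rows of every input array run along the last dimension of the grid, so they have length up
  -- to μ. This matters because σ may be smaller than `B`.
  have hlast : ∀ j : Fin (e + 1), j.castSucc.succAbove (Fin.last e) = Fin.last (e + 1) :=
    fun j => by simp
  calc ((inpLines B inp lo len).card : ℝ)
      ≤ ∑ j : Fin (e + 1), ((boxLines B (inp j) (j.castSucc.removeNth lo)
          (j.castSucc.removeNth len)).card : ℝ) := by
        exact_mod_cast Finset.card_biUnion_le
    _ ≤ ∑ _j : Fin (e + 1), σ ^ e * (μ / B + 2) := by
        refine Finset.sum_le_sum fun j _ => ?_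
        refine le_trans (by exact_mod_cast card_boxLines_le hB (hinp j _ _)) (card_rows_le hB ?_ ?_)
        · intro l
          have hne : j.castSucc.succAbove l.castSucc ≠ Fin.last (e + 1) := fun e' =>
            (Fin.castSucc_lt_last l).ne (Fin.succAbove_right_injective (e'.trans (hlast j).symm))
          obtain ⟨i, hi⟩ := Fin.exists_castSucc_eq.2 hne
          rw [Fin.removeNth, ← hi]
          exact h.1 i
        · rw [Fin.removeNth, hlast]
          exact h.2
    _ = _ := by simp

variable {σ μ : ℝ}

/-- Outputs and stack are pinned, so only the input lines are loaded, once. Their number is spread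
over the cells, of which there are at least σ^(e+1) μ / 3^(e+2). -/
theorem pinnedReads_trace_of_isSmall (hop : ∀ u v w, op (op u v) w = op u (op v w))
    (hs : IsScale ω σ μ (e + 1)) (hinp : ∀ j a m, RowContiguous (inp j) a m) (hB : 1 ≤ B)
    {P : Finset ℕ} (hcap : (P.card + (e + 1) * (σ ^ e * (μ / B + 2))) * B ≤ M)
    {lo len : Fin (e + 2) → ℕ} (hl : ∀ j, 1 ≤ len j) (hlarge : IsLarge σ μ len)
    (hsmall : IsSmall σ μ len) (out : (Fin (e + 1) → ℕ) → ℕ) (sp : ℕ)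
    (hP : ∀ a ∈ outSet lo len out ∪
      Set.Ico sp (sp + (asymAlg ω op g inp lo len out).seqSpace sp), a / B ∈ P) :
    PinnedReads M B P ((asymAlg ω op g inp lo len out).trace sp)
      (3 ^ (e + 2) * ((e + 1) * (σ ^ e * (μ / B + 2))) / (σ ^ (e + 1) * μ) * vol len) := by
  have hgood := good_trace ω g inp hop lo len hl out sp
  have hX := card_inpLines_le inp hB hinp (lo := lo) hsmall
  have hB' : (1 : ℝ) ≤ B := by exact_mod_cast hB
  have hPX : (P ∪ inpLines B inp lo len).card * B ≤ M := by
    have h1 : ((P ∪ inpLines B inp lo len).card : ℝ) ≤ P.card + (inpLines B inp lo len).card := by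
      exact_mod_cast Finset.card_union_le _ _
    have h2 : ((P ∪ inpLines B inp lo len).card : ℝ) * B ≤ M :=
      le_trans (by gcongr; linarith) hcap
    exact_mod_cast h2
  refine (pinnedReads_of_mem hPX (fun i hi => hP _ (hgood.dst i hi)) fun i hi t => ?_).mono ?_
  · rcases hgood.src i hi t with h | h
    · exact Finset.mem_union_right _ (div_mem_inpLines inp h)
    · exact Finset.mem_union_left _ (hP _ (.inr h))
  · have hσ := hs.one_le_σ
    have hμ := hs.one_le_μ
    have hv := hlarge.le_vol (by linarith) (by linarith)
    refine hX.trans ?_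
    rw [div_mul_eq_mul_div, le_div_iff₀ (by positivity)]
    calc (e + 1) * (σ ^ e * (μ / B + 2)) * (σ ^ (e + 1) * μ)
        ≤ (e + 1) * (σ ^ e * (μ / B + 2)) * (3 ^ (e + 1 + 1) * vol len) := by gcongr
      _ = _ := by ring

/-- Above the small boxes the reads add up like the volumes: the addition loops touch only pinned
lines and cost nothing. -/
theorem pinnedReads_trace (hop : ∀ u v w, op (op u v) w = op u (op v w))
    (hs : IsScale ω σ μ (e + 1)) (hinp : ∀ j a m, RowContiguous (inp j) a m) (hB : 1 ≤ B)
    {P : Finset ℕ} (hcap : (P.card + (e + 1) * (σ ^ e * (μ / B + 2))) * B ≤ M)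
    (lo len : Fin (e + 2) → ℕ) (hl : ∀ j, 1 ≤ len j) (hlarge : IsLarge σ μ len)
    (out : (Fin (e + 1) → ℕ) → ℕ) (sp : ℕ)
    (hP : ∀ a ∈ outSet lo len out ∪
      Set.Ico sp (sp + (asymAlg ω op g inp lo len out).seqSpace sp), a / B ∈ P) :
    PinnedReads M B P ((asymAlg ω op g inp lo len out).trace sp)
      (3 ^ (e + 2) * ((e + 1) * (σ ^ e * (μ / B + 2))) / (σ ^ (e + 1) * μ) * vol len) := by
  revert hlarge out sp
  refine box_induction ω (motive := fun lo len => IsLarge σ μ len → ∀ out sp,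
    (∀ a ∈ outSet lo len out ∪
      Set.Ico sp (sp + (asymAlg ω op g inp lo len out).seqSpace sp), a / B ∈ P) →
    PinnedReads M B P ((asymAlg ω op g inp lo len out).trace sp)
      (3 ^ (e + 2) * ((e + 1) * (σ ^ e * (μ / B + 2))) / (σ ^ (e + 1) * μ) * vol len))
    ?_ ?_ lo len hl
  · intro lo len h1 _ hlarge out sp hP
    exact pinnedReads_trace_of_isSmall g inp hop hs hinp hB hcap (fun j => (h1 j).ge) hlarge
      ⟨fun j => by simpa [h1] using hs.one_le_σ, by simpa [h1] using hs.one_le_μ⟩ out sp hP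
  · intro lo len i hl hi h ih1 ih2 hlarge out sp hP
    by_cases hsmall : IsSmall σ μ len
    · exact pinnedReads_trace_of_isSmall g inp hop hs hinp hB hcap hl hlarge hsmall out sp hP
    obtain ⟨hl₁, hl₂⟩ := hlarge.halves hs h hsmall
    have ih1 := ih1 hl₁
    have ih2 := ih2 hl₂
    set κ := 3 ^ (e + 2) * ((e + 1) * (σ ^ e * (μ / B + 2))) / (σ ^ (e + 1) * μ)
    have hv : κ * vol len = κ * vol (len₁ len i) + κ * vol (len₂ len i) := by
      rw [← vol_halves len i]; push_cast; ring
    rw [hv]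
    by_cases hil : i = Fin.last (e + 1)
    · subst hil
      rw [asymAlg_last _ _ _ _ _ _ h] at hP ⊢
      simp only [Prog.trace, Prog.trace_parFor_instr, Prog.seqSpace,
        Prog.seqSpace_parFor_instr] at hP ⊢
      rw [← add_zero (_ + _ : ℝ)]
      refine ((ih1 _ _ ?_).append (ih2 _ _ ?_)).append ?_
      · rintro a (⟨y, hy, rfl⟩ | ha)
        · rw [outBox_len₁_last] at hy
          have := tempAddr_mem hy sp
          exact hP _ (.inr ⟨this.1, by have := this.2; omega⟩)
        · have h1 := ha.1
          have h2 := ha.2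
          exact hP _ (.inr ⟨by omega, by omega⟩)
      · rintro a (⟨y, hy, rfl⟩ | ha)
        · rw [outBox_len₂_last] at hy
          have := tempAddr_mem hy (sp + area len)
          exact hP _ (.inr ⟨by have := this.1; omega, by have := this.2; omega⟩)
        · have h1 := ha.1
          have h2 := ha.2
          exact hP _ (.inr ⟨by omega, by omega⟩)
      · refine PinnedReads.mono (ρ := ((∅ : Finset ℕ).card : ℝ)) ?_ (by simp)
        have hPM : P.card * B ≤ M := by
          have hσ := hs.one_le_σ
          have hμ := hs.one_le_μ
          have h2 : (P.card : ℝ) * B ≤ M :=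
            le_trans (mul_le_mul_of_nonneg_right (le_add_of_nonneg_right (by positivity))
              (by positivity)) hcap
          exact_mod_cast h2
        refine pinnedReads_of_mem (by simpa using hPM) (fun i hi => ?_) fun i hi t => ?_
        · obtain ⟨t, -, rfl⟩ := List.mem_map.1 hi
          exact hP _ (.inl (Set.mem_image_of_mem _ (outIndex_mem hl t)))
        · obtain ⟨u, hu, rfl⟩ := List.mem_map.1 hi
          rw [List.mem_range'_1] at hu
          rw [Finset.union_empty]
          change Fin 2 at t
          fin_cases t
          · change (sp + u) / B ∈ P
            exact hP _ (.inr ⟨by omega, by omega⟩)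
          · change (sp + area len + u) / B ∈ P
            exact hP _ (.inr ⟨by omega, by omega⟩)
    · rw [asymAlg_other _ _ _ _ _ _ h hil] at hP ⊢
      simp only [Prog.trace, Prog.seqSpace] at hP ⊢
      refine (ih1 _ _ ?_).append (ih2 _ _ ?_)
      · rintro a (⟨y, hy, rfl⟩ | ha)
        · exact hP _ (.inl ⟨y, outBox_len₁_subset _ _ _ hy, rfl⟩)
        · exact hP _ (.inr ⟨ha.1, by have := ha.2; omega⟩)
      · rintro a (⟨y, hy, rfl⟩ | ha)
        · exact hP _ (.inl ⟨y, outBox_len₂_subset _ _ _ hy, rfl⟩)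
        · exact hP _ (.inr ⟨ha.1, by have := ha.2; omega⟩)

/-- The assumptions on the parameters of the upper bound: boxes of size about
`s × ⋯ × s × (s * q)` are executed while their output and the stack stay in the cache, and boxes of
size about `σ × ⋯ × σ × μ` are executed while their input stays in the cache as well. -/
structure Params (ω : ℝ) (M B e : ℕ) (s q σ μ : ℝ) : Prop where
  one_le_ω : 1 ≤ ω
  one_le_B : 1 ≤ B
  one_le_q : 1 ≤ q
  weight : dimWeight ω (Fin.last (e + 1)) = q⁻¹
  outer : IsScale ω s (s * q) (e + 1)
  inner : IsScale ω σ μ (e + 1)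
  σ_le : σ ≤ s
  μ_le : μ ≤ s * q
  B_le : 3 * (B : ℝ) ≤ s
  clog_le : ∀ m : ℕ, (m : ℝ) ≤ s * q → (Nat.clog 2 m : ℝ) ≤ 6 * s ^ (e + 1)
  inp_le : σ ^ e * (μ / B + 2) * B ≤ 3 * s ^ (e + 1)
  le_M : (21 + 3 * (e + 1)) * s ^ (e + 1) ≤ M

variable {s q : ℝ}

/-- The lines of the output and of the stack are pinned; they occupy at most 21 s^(e+1) words, so
loading and writing them back costs at most 42ω s^(e+1)/B. Another 36 establishes the potential of
`freshCost_trace`, which gives 78. -/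
theorem freshCost_trace_of_isSmall (hop : ∀ u v w, op (op u v) w = op u (op v w))
    (hp : Params ω M B e s q σ μ) (hinp : ∀ j a m, RowContiguous (inp j) a m)
    {lo len : Fin (e + 2) → ℕ} (hl : ∀ j, 1 ≤ len j) (hlarge : IsLarge s (s * q) len)
    (hsmall : IsSmall s (s * q) len) {out : (Fin (e + 1) → ℕ) → ℕ}
    (hout : RowContiguous out (fun j => lo j.castSucc) (fun j => len j.castSucc)) (sp : ℕ) :
    FreshCost M B ω ((asymAlg ω op g inp lo len out).trace sp)
      ((3 ^ (e + 2) * ((e + 1) * (σ ^ e * (μ / B + 2))) / (σ ^ (e + 1) * μ)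
        + 3 ^ (e + 2) * 78 * ω / (s * q * B)) * vol len - 36 * ω * area len / B) := by
  have hB := hp.one_le_B
  have hB' : (1 : ℝ) ≤ B := by exact_mod_cast hB
  have hs := hp.outer.one_le_σ
  have hq := hp.one_le_q
  have hω := hp.one_le_ω
  have hBs := hp.B_le
  have hpow : s ≤ s ^ (e + 1) := le_self_pow₀ hs (by omega)
  set T := (asymAlg ω op g inp lo len out).seqSpace sp with hT
  set P := boxLines B out (fun j => lo j.castSucc) (fun j => len j.castSucc)
    ∪ intervalLines B sp T with hPdef
  have hTle : (T : ℝ) ≤ 18 * s ^ (e + 1) := by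
    have h1 := seqSpace_le op g inp (by omega) hq hp.weight lo len hl out sp
    have h2 : (len (Fin.last (e + 1)) / q : ℝ) ^ (e + 1) ≤ s ^ (e + 1) := by
      refine pow_le_pow_left₀ (by positivity) ?_ _
      rw [div_le_iff₀ (by linarith)]
      exact hsmall.2
    have h3 := hp.clog_le _ hsmall.2
    linarith
  have hPcard : (P.card : ℝ) * B ≤ 21 * s ^ (e + 1) := by
    have h1 : (P.card : ℝ) ≤ (boxLines B out (fun j => lo j.castSucc)
        (fun j => len j.castSucc)).card + (intervalLines B sp T).card := by
      exact_mod_cast Finset.card_union_le _ _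
    have h2 : ((boxLines B out (fun j => lo j.castSucc) (fun j => len j.castSucc)).card : ℝ)
        ≤ s ^ e * (s / B + 2) :=
      le_trans (by exact_mod_cast card_boxLines_le hB hout)
        (card_rows_le (n := fun j => len j.castSucc) hB (fun j => hsmall.1 _) (hsmall.1 _))
    have h3 : ((intervalLines B sp T).card : ℝ) ≤ T / B + 2 := by
      have : ((intervalLines B sp T).card : ℝ) ≤ (T / B : ℕ) + 2 := by
        exact_mod_cast card_intervalLines_le hB sp T
      exact this.trans (by gcongr; exact Nat.cast_div_le)
    calc (P.card : ℝ) * B ≤ (s ^ e * (s / B + 2) + (T / B + 2)) * B := by gcongr; linarith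
      _ = s ^ e * (s + 2 * B) + T + 2 * B := by field_simp; ring
      _ ≤ s ^ e * (s + s) + 18 * s ^ (e + 1) + s ^ (e + 1) := by
          gcongr
          · linarith
          · linarith
      _ = 21 * s ^ (e + 1) := by ring
  have hcap : (P.card + (e + 1) * (σ ^ e * (μ / B + 2))) * B ≤ M := by
    refine le_trans ?_ hp.le_M
    have := hp.inp_le
    calc (P.card + (e + 1) * (σ ^ e * (μ / B + 2))) * (B : ℝ)
        = P.card * B + (e + 1) * (σ ^ e * (μ / B + 2) * B) := by ring
      _ ≤ 21 * s ^ (e + 1) + (e + 1) * (3 * s ^ (e + 1)) := by gcongr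
      _ = _ := by ring
  have hin := pinnedReads_trace g inp hop hp.inner hinp hB hcap lo len hl
    ⟨fun j => hp.σ_le.trans (hlarge.1 j), hp.μ_le.trans hlarge.2⟩ out sp ?_
  · have hPM : P.card * B ≤ M := by
      have h1 : (P.card : ℝ) * B ≤ M := by
        have := hp.le_M
        have h0 : (0 : ℝ) ≤ 3 * (e + 1) * s ^ (e + 1) := by positivity
        linarith
      exact_mod_cast h1
    refine (hin.freshCost hPM (by linarith)).mono ?_
    have hv := hlarge.le_vol (by linarith) (by positivity)
    have hA := hsmall.area_le
    have h1 : (P.card : ℝ) * (1 + ω) ≤ 42 * ω * s ^ (e + 1) / B := by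
      rw [le_div_iff₀ (by linarith)]
      nlinarith
    have h2 : 36 * ω * area len / B ≤ 36 * ω * s ^ (e + 1) / B := by gcongr
    have h3 : 78 * ω * s ^ (e + 1) / B ≤ 3 ^ (e + 2) * 78 * ω / (s * q * B) * vol len := by
      rw [div_mul_eq_mul_div, div_le_div_iff₀ (by linarith) (by positivity)]
      calc 78 * ω * s ^ (e + 1) * (s * q * B) = 78 * ω * B * (s ^ (e + 1) * (s * q)) := by ring
        _ ≤ 78 * ω * B * (3 ^ (e + 1 + 1) * vol len) := by gcongr
        _ = _ := by ring
    have h4 : 42 * ω * s ^ (e + 1) / B + 36 * ω * s ^ (e + 1) / B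
        = 78 * ω * s ^ (e + 1) / B := by ring
    rw [add_mul]
    linarith
  · rintro a (⟨y, hy, rfl⟩ | ha)
    · exact Finset.mem_union_left _ (Finset.mem_image_of_mem _ hy)
    · exact Finset.mem_union_right _ (Finset.mem_image_of_mem _ (Finset.mem_Ico.2 ha))

/-- The subtracted area term is the potential: two halves along the last dimension subtract it
twice, and the surplus is exactly the cost of the addition loop. For the other splits it is
additive. -/
theorem freshCost_trace (hop : ∀ u v w, op (op u v) w = op u (op v w))
    (hp : Params ω M B e s q σ μ) (hinp : ∀ j a m, RowContiguous (inp j) a m)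
    (lo len : Fin (e + 2) → ℕ) (hl : ∀ j, 1 ≤ len j) (hlarge : IsLarge s (s * q) len)
    (out : (Fin (e + 1) → ℕ) → ℕ)
    (hout : RowContiguous out (fun j => lo j.castSucc) (fun j => len j.castSucc)) (sp : ℕ) :
    FreshCost M B ω ((asymAlg ω op g inp lo len out).trace sp)
      ((3 ^ (e + 2) * ((e + 1) * (σ ^ e * (μ / B + 2))) / (σ ^ (e + 1) * μ)
        + 3 ^ (e + 2) * 78 * ω / (s * q * B)) * vol len - 36 * ω * area len / B) := by
  set α := 3 ^ (e + 2) * ((e + 1) * (σ ^ e * (μ / B + 2))) / (σ ^ (e + 1) * μ)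
        + 3 ^ (e + 2) * 78 * ω / (s * q * B) with hα
  revert hlarge out sp
  refine box_induction ω (motive := fun lo len => IsLarge s (s * q) len → ∀ out,
    RowContiguous out (fun j => lo j.castSucc) (fun j => len j.castSucc) → ∀ sp,
    FreshCost M B ω ((asymAlg ω op g inp lo len out).trace sp)
      (α * vol len - 36 * ω * area len / B)) ?_ ?_ lo len hl
  · intro lo len h1 _ hlarge out hout sp
    exact freshCost_trace_of_isSmall g inp hop hp hinp (fun j => (h1 j).ge) hlarge
      ⟨fun j => by simpa [h1] using hp.outer.one_le_σ,
        by simpa [h1] using hp.outer.one_le_μ⟩ hout sp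
  · intro lo len i hl hi h ih1 ih2 hlarge out hout sp
    by_cases hsmall : IsSmall s (s * q) len
    · exact freshCost_trace_of_isSmall g inp hop hp hinp hl hlarge hsmall hout sp
    obtain ⟨hl₁, hl₂⟩ := hlarge.halves hp.outer h hsmall
    have ih1 := ih1 hl₁
    have ih2 := ih2 hl₂
    have hv : α * vol len = α * vol (len₁ len i) + α * vol (len₂ len i) := by
      rw [← vol_halves len i]; push_cast; ring
    rw [hv]
    have hpow : s ≤ s ^ (e + 1) := le_self_pow₀ hp.outer.one_le_σ (by omega)
    have hs0 := hp.outer.one_le_σ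
    have hBs := hp.B_le
    by_cases hil : i = Fin.last (e + 1)
    · subst hil
      rw [area_len₁_last] at ih1
      rw [area_len₂_last] at ih2
      rw [asymAlg_last _ _ _ _ _ _ h]
      simp only [Prog.trace, Prog.trace_parFor_instr]
      have hM : 9 * B ≤ M := by
        have h1 : (9 : ℝ) * B ≤ M := by
          have := hp.le_M
          have h0 : (0 : ℝ) ≤ 3 * (e + 1) * s ^ (e + 1) := by positivity
          linarith
        exact_mod_cast h1
      -- The factor 3 in `B_le` compensates the one in `IsLarge`.
      have hBlen : B ≤ len (Fin.last e).castSucc := by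
        have h1 : (B : ℝ) ≤ len (Fin.last e).castSucc := by
          have := hlarge.1 (Fin.last e)
          linarith
        exact_mod_cast h1
      have h1 := ih1 (tempAddr sp lo len)
        (by simpa using rowContiguous_tempAddr sp lo len) (sp + area len + area len)
      have h2 := ih2 (tempAddr (sp + area len) lo len)
        (by simpa using rowContiguous_tempAddr (sp + area len) lo len) (sp + area len + area len)
      have h3 := freshCost_addInstr (op := op) hp.one_le_ω hp.one_le_B hM hout hl sp
        (sp + area len) hBlen
      exact ((h1.append h2).append h3).mono (by linarith)
    · rw [asymAlg_other _ _ _ _ _ _ h hil]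
      have hA : 36 * ω * area len / B
          = 36 * ω * area (len₁ len i) / B + 36 * ω * area (len₂ len i) / B := by
        rw [← area_halves (len := len) hil]; push_cast; ring
      rw [hA]
      exact ((ih1 out (hout.mono (outBox_len₁_subset _ _ _)) sp).append
        (ih2 out (hout.mono (outBox_len₂_subset _ _ _)) sp)).mono (by linarith)

end upper

/-! ### The choice of the scales and the two cache bounds -/

section bounds

variable {V : Type*} {M B d e : ℕ} {ω : ℝ} {op : V → V → V}

/-- The weight of the last dimension and the powers of `ω` in terms of `p = ω ^ (1 / k)`. -/
theorem exists_root {ω : ℝ} (hω : 1 ≤ ω) (d : ℕ) :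
    ∃ p : ℝ, 1 ≤ p ∧ p ^ (d + 1) = ω ∧ ω ^ (1 / ((d : ℝ) + 1)) = p ∧
      ω ^ ((d : ℝ) / ((d : ℝ) + 1)) = p ^ d ∧
      dimWeight ω (Fin.last d) = (p ^ d)⁻¹ := by
  have h0 : 0 ≤ ω := by linarith
  have h1 : ω ^ ((d : ℝ) / ((d : ℝ) + 1)) = (ω ^ (1 / ((d : ℝ) + 1))) ^ d := by
    rw [← Real.rpow_mul_natCast h0]
    congr 1
    ring
  refine ⟨ω ^ (1 / ((d : ℝ) + 1)), Real.one_le_rpow hω (by positivity), ?_, rfl, h1, ?_⟩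
  · rw [← Real.rpow_mul_natCast h0]
    push_cast
    rw [one_div, inv_mul_cancel₀ (by positivity), Real.rpow_one]
  · rw [dimWeight, if_pos rfl, Real.rpow_neg h0, h1]

theorem rpow_one_div_pow {M d : ℕ} (hd : 1 ≤ d) : ((M : ℝ) ^ (1 / (d : ℝ))) ^ d = M := by
  rw [← Real.rpow_mul_natCast (Nat.cast_nonneg M), one_div,
    inv_mul_cancel₀ (by positivity), Real.rpow_one]

theorem cacheBound_le_asymCacheComplexity (g : (Fin (d + 1) → ℕ) → (Fin d → V) → V)
    (hop : ∀ u v w, op (op u v) w = op u (op v w)) (hd : 1 ≤ d) (hω : 1 ≤ ω) (hB : 1 ≤ B)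
    (hM : 1 ≤ M) {n : ℕ} (hn : 1 ≤ n) :
    ENNReal.ofReal (1 / 10 * cacheBound d n ω M B)
      ≤ asymCacheComplexity M B ω ((gridProg ω op g n).trace (stackBase d n)) := by
  obtain ⟨p, hp1, hpω, hp, -, hw⟩ := exists_root hω d
  have hB' : (1 : ℝ) ≤ B := by exact_mod_cast hB
  have hS : (1 : ℝ) ≤ (M : ℝ) ^ (1 / (d : ℝ)) :=
    Real.one_le_rpow (by exact_mod_cast hM) (by positivity)
  refine le_iInf fun r => le_iInf fun w => le_iInf fun h => ENNReal.ofReal_le_ofReal ?_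
  have h1 := le_writes_gridProg g hop hd hS (rpow_one_div_pow hd) hB (one_le_pow₀ hp1) hw hn h
  rw [cacheBound, hp]
  set S := (M : ℝ) ^ (1 / (d : ℝ))
  have h2 : 1 / 10 * ((n : ℝ) ^ (d + 1) * p / (S * B))
      = ω * ((n : ℝ) ^ (d + 1) / (10 * S * p ^ d * B)) := by
    rw [← hpω]
    field_simp
    ring
  rw [h2]
  have h3 := mul_le_mul_of_nonneg_left h1 (by linarith : 0 ≤ ω)
  have : (0 : ℝ) ≤ r := Nat.cast_nonneg r
  linarith

theorem isScale_outer {p s : ℝ} (hp1 : 1 ≤ p) (hs : 1 ≤ s)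
    (hw : dimWeight ω (Fin.last d) = (p ^ d)⁻¹) : IsScale ω s (s * p ^ d) d := by
  have hq : 1 ≤ p ^ d := one_le_pow₀ hp1
  have h : s * p ^ d * dimWeight ω (Fin.last d) = s := by rw [hw]; field_simp
  exact ⟨hs, one_le_mul_of_one_le_of_one_le hs hq, by rw [hw]; positivity, h.le, .inr h.ge⟩

/-- An input face of extents σ, ..., σ, μ has s^(e+1) entries by the choice of μ. For σ = s/p the
weighted extents are equal. If s < p, σ is raised to 1, and μ weighted stays below it. -/
theorem isScale_inner {p s : ℝ} (hp1 : 1 ≤ p) (hs : 1 ≤ s)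
    (hw : dimWeight ω (Fin.last (e + 1)) = (p ^ (e + 1))⁻¹) :
    IsScale ω (max 1 (s / p)) (s ^ (e + 1) / (max 1 (s / p)) ^ e) (e + 1) ∧
      max 1 (s / p) ≤ s ∧ s ≤ s ^ (e + 1) / (max 1 (s / p)) ^ e ∧
      s ^ (e + 1) / (max 1 (s / p)) ^ e ≤ max 1 (s / p) * p ^ (e + 1) := by
  set σ := max 1 (s / p) with hσ
  have hp0 : 0 < p := by linarith
  have hσ1 : 1 ≤ σ := le_max_left _ _
  have hσs : σ ≤ s := max_le hs (div_le_self (by linarith) hp1)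
  have hsσ : s ≤ σ * p := by
    rw [← div_le_iff₀ hp0]; exact le_max_right _ _
  have hμs : s ≤ s ^ (e + 1) / σ ^ e := by
    rw [le_div_iff₀ (by positivity), pow_succ, mul_comm]
    gcongr
  have hμ : s ^ (e + 1) / σ ^ e ≤ σ * p ^ (e + 1) := by
    rw [div_le_iff₀ (by positivity)]
    calc s ^ (e + 1) ≤ (σ * p) ^ (e + 1) := by gcongr
      _ = _ := by ring
  refine ⟨⟨hσ1, hs.trans hμs, by rw [hw]; positivity, ?_, ?_⟩, hσs, hμs, hμ⟩
  · rw [hw, ← div_eq_mul_inv, div_le_iff₀ (by positivity)]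
    exact hμ
  · rcases max_choice 1 (s / p) with h | h
    · exact .inl h
    · right
      rw [← hσ] at h
      rw [hw, h, div_pow]
      refine le_of_eq ?_
      field_simp
      ring

/-- The logarithm of p^(d+1) is at most log ω. This is where the assumption relating M and log ω
enters. -/
theorem clog_le_of_le_mul {p s : ℝ} (hp1 : 1 ≤ p) (hpω : p ^ (d + 2) = ω) (hs : 1 ≤ s)
    (hlog : Real.log ω ≤ s ^ (d + 1)) {m : ℕ} (hm : (m : ℝ) ≤ s * p ^ (d + 1)) :
    (Nat.clog 2 m : ℝ) ≤ 6 * s ^ (d + 1) := by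
  rcases Nat.lt_or_ge m 2 with h | h
  · rw [Nat.clog_of_right_le_one (by omega)]
    simp only [Nat.cast_zero]
    positivity
  · have hs0 : 0 < s := by linarith
    have hp0 : 0 < p := by linarith
    have h1 : Real.log m ≤ Real.log s + Real.log (p ^ (d + 1)) := by
      rw [← Real.log_mul (by positivity) (by positivity)]
      exact Real.log_le_log (by positivity) hm
    have h2 : Real.log (p ^ (d + 1)) ≤ Real.log ω := by
      refine Real.log_le_log (by positivity) ?_
      rw [← hpω]
      exact pow_le_pow_right₀ hp1 (by omega)
    have h3 : Real.log s ≤ s := Real.log_le_self hs0.le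
    have h4 : s ≤ s ^ (d + 1) := le_self_pow₀ hs (by omega)
    have h5 := clog_le_three_mul_log h
    linarith

/-- The size of the boxes whose output is kept in the cache, relative to `M ^ (1 / (k - 1))`. -/
noncomputable def cacheScale (e : ℕ) : ℝ := 1 / (21 + 3 * (e + 1))

theorem cacheScale_pos (e : ℕ) : 0 < cacheScale e := by unfold cacheScale; positivity

theorem cacheScale_le_one (e : ℕ) : cacheScale e ≤ 1 := by
  unfold cacheScale
  rw [div_le_one (by positivity)]
  have : (0 : ℝ) ≤ e := Nat.cast_nonneg e
  linarith

theorem asymCacheComplexity_le_cacheBound (g : (Fin (e + 2) → ℕ) → (Fin (e + 1) → V) → V)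
    (hop : ∀ u v w, op (op u v) w = op u (op v w)) (hω : 1 ≤ ω) (hB : 1 ≤ B)
    (hMB : (3 / cacheScale e) ^ (e + 1) * (B : ℝ) ^ (e + 1) ≤ M)
    (hMω : (3 / cacheScale e) ^ (e + 1) * Real.log ω ≤ M) {n : ℕ} (hn : 1 ≤ n)
    (hnM : ω ^ (((e + 1 : ℕ) : ℝ) / (((e + 1 : ℕ) : ℝ) + 1)) * (M : ℝ) ^ (1 / ((e + 1 : ℕ) : ℝ))
      ≤ n) :
    asymCacheComplexity M B ω ((gridProg ω op g n).trace (stackBase (e + 1) n))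
      ≤ ENNReal.ofReal ((3 ^ (e + 3) * (e + 1) + 3 ^ (e + 2) * 78) / cacheScale e
          * cacheBound (e + 1) n ω M B) := by
  obtain ⟨p, hp1, hpω, hp, hpd, hw⟩ := exists_root hω (e + 1)
  have hB' : (1 : ℝ) ≤ B := by exact_mod_cast hB
  have hS := rpow_one_div_pow (M := M) (d := e + 1) (by omega)
  rw [cacheBound, hp]
  rw [hpd] at hnM
  have hS0 : 0 ≤ (M : ℝ) ^ (1 / ((e + 1 : ℕ) : ℝ)) := by positivity
  set S := (M : ℝ) ^ (1 / ((e + 1 : ℕ) : ℝ))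
  have hδ0 := cacheScale_pos e
  have hδ1 := cacheScale_le_one e
  set δ := cacheScale e with hδ
  obtain ⟨s, hs⟩ : ∃ s, s = δ * S := ⟨_, rfl⟩
  -- The constant (3 / δ)^(e+1) in the assumption is chosen for this inequality.
  have hBs : 3 * (B : ℝ) ≤ s := by
    rw [← hS, ← mul_pow] at hMB
    have := le_of_pow_le_pow_left₀ (by omega) hS0 hMB
    rw [div_mul_eq_mul_div, div_le_iff₀ hδ0] at this
    rw [hs]
    linarith
  have hs1 : 1 ≤ s := by linarith
  have hspow : s ^ (e + 1) = δ ^ (e + 1) * M := by rw [hs, mul_pow, hS]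
  have hlog : Real.log ω ≤ s ^ (e + 1) := by
    have h1 : (1 : ℝ) ≤ 3 ^ (e + 1) := one_le_pow₀ (by norm_num)
    rw [div_pow, div_mul_eq_mul_div, div_le_iff₀ (by positivity)] at hMω
    have h2 := Real.log_nonneg hω
    rw [hspow]
    nlinarith
  obtain ⟨hin, hσs, hsμ, hμ⟩ := isScale_inner (e := e) hp1 hs1 hw
  have hσp : s ≤ max 1 (s / p) * p := by
    rw [← div_le_iff₀ (by linarith)]; exact le_max_right _ _
  have hσμ : (max 1 (s / p)) ^ e * (s ^ (e + 1) / (max 1 (s / p)) ^ e) = s ^ (e + 1) :=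
    mul_div_cancel₀ _ (by positivity)
  have hσ1 := hin.one_le_σ
  have hμ1 := hin.one_le_μ
  set σ := max 1 (s / p)
  set μ := s ^ (e + 1) / σ ^ e
  have hq1 : 1 ≤ p ^ (e + 1) := one_le_pow₀ hp1
  have hparams : Params ω M B e s (p ^ (e + 1)) σ μ := by
    refine ⟨hω, hB, hq1, hw, isScale_outer hp1 hs1 hw, hin, hσs, hμ.trans (by gcongr), hBs,
      fun m hm => clog_le_of_le_mul hp1 hpω hs1 hlog hm, ?_, ?_⟩
    · calc σ ^ e * (μ / B + 2) * B = σ ^ e * μ + σ ^ e * (2 * B) := by field_simp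
        _ ≤ s ^ (e + 1) + s ^ e * s := by
            rw [hσμ]; gcongr; linarith
        _ = 2 * s ^ (e + 1) := by ring
        _ ≤ 3 * s ^ (e + 1) := by gcongr; norm_num
    · calc (21 + 3 * ((e : ℝ) + 1)) * s ^ (e + 1) = δ⁻¹ * (δ ^ (e + 1) * M) := by
            rw [hspow, hδ, cacheScale, one_div, inv_inv]
        _ = δ ^ e * M := by field_simp; ring
        _ ≤ 1 * M := by gcongr; exact pow_le_one₀ hδ0.le hδ1
        _ = M := one_mul _
  have hsn : s * p ^ (e + 1) ≤ n := by
    refine le_trans ?_ hnM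
    rw [mul_comm, hs]
    gcongr
    exact mul_le_of_le_one_left hS0 hδ1
  have hlarge : IsLarge s (s * p ^ (e + 1)) (fun _ : Fin (e + 2) => n) := by
    have h1 : s ≤ s * p ^ (e + 1) := le_mul_of_one_le_right (by linarith) hq1
    have h2 : (0 : ℝ) ≤ n := Nat.cast_nonneg n
    exact ⟨fun _ => by linarith, by linarith⟩
  refine (freshCost_trace g (inputAddr n) hop hparams (rowContiguous_inputAddr n) _ _
    (fun _ => hn) hlarge _ (rowContiguous_outputAddr n _ _) _).asymCacheComplexity_le.trans
    (ENNReal.ofReal_le_ofReal ?_)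
  have hv : (vol (fun _ : Fin (e + 2) => n) : ℝ) = (n : ℝ) ^ (e + 1 + 1) := by simp [vol]
  rw [hv]
  have h1 : 3 ^ (e + 2) * ((e + 1) * (σ ^ e * (μ / B + 2))) / (σ ^ (e + 1) * μ)
      ≤ 3 ^ (e + 3) * (e + 1) * p / (s * B) := by
    have h2 : μ / B + 2 ≤ 3 * μ / B := by
      rw [div_add' _ _ _ (by positivity)]
      gcongr
      linarith
    -- Since μ ≥ s ≥ B, rows of length μ absorb the rounding term; then 1/σ ≤ p/s.
    calc 3 ^ (e + 2) * ((e + 1) * (σ ^ e * (μ / B + 2))) / (σ ^ (e + 1) * μ)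
        ≤ 3 ^ (e + 2) * ((e + 1) * (σ ^ e * (3 * μ / B))) / (σ ^ (e + 1) * μ) := by gcongr
      _ = 3 ^ (e + 3) * (e + 1) / (σ * B) := by field_simp; ring
      _ ≤ 3 ^ (e + 3) * (e + 1) * p / (s * B) := by
          rw [div_le_div_iff₀ (by positivity) (by positivity)]
          calc 3 ^ (e + 3) * ((e : ℝ) + 1) * (s * B)
              ≤ 3 ^ (e + 3) * ((e : ℝ) + 1) * (σ * p * B) := by gcongr
            _ = _ := by ring
  have h3 : 3 ^ (e + 2) * 78 * ω / (s * p ^ (e + 1) * B) = 3 ^ (e + 2) * 78 * p / (s * B) := by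
    rw [← hpω]; field_simp; ring
  rw [h3]
  have h4 : 0 ≤ 36 * ω * area (fun _ : Fin (e + 2) => n) / B := by positivity
  have hS1 : 0 < S := by
    refine hS0.lt_of_ne fun h0 => ?_
    rw [← h0, mul_zero] at hs
    linarith
  calc _ ≤ (3 ^ (e + 3) * ((e : ℝ) + 1) * p / (s * B) + 3 ^ (e + 2) * 78 * p / (s * B))
        * (n : ℝ) ^ (e + 1 + 1) := by
        refine (sub_le_self _ h4).trans ?_
        gcongr
    _ = _ := by
        rw [hs]; field_simp

end bounds

end KDGrid

theorem mainTheorem4 (d : ℕ) (hd : 1 ≤ d) :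
    ∃ c C τ : ℝ, 0 < c ∧ 0 < C ∧ 0 < τ ∧
      ∀ (V : Type*) (op : V → V → V) (_ : ∀ u v w : V, op (op u v) w = op u (op v w))
        (g : (Fin (d + 1) → ℕ) → (Fin d → V) → V) (n : ℕ) (_ : 1 ≤ n) (ω : ℝ) (_ : 1 ≤ ω),
        -- correctness, of the sequential and of every parallel execution
        (KDGrid.Computes op g n ((KDGrid.gridProg ω op g n).trace (KDGrid.stackBase d n)) ∧
          ∀ l : List (KDGrid.Instr V),
            (KDGrid.gridProg ω op g n).IsSchedule (KDGrid.stackBase d n) l →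
              KDGrid.Computes op g n l) ∧
        -- work
        (c * (n : ℝ) ^ (d + 1) ≤ ((KDGrid.gridProg ω op g n).work (KDGrid.stackBase d n) : ℝ) ∧
          ((KDGrid.gridProg ω op g n).work (KDGrid.stackBase d n) : ℝ)
            ≤ C * (n : ℝ) ^ (d + 1)) ∧
        -- span
        (2 ≤ n →
          ((KDGrid.gridProg ω op g n).span (KDGrid.stackBase d n) : ℝ)
            ≤ C * (Real.log (n : ℝ)) ^ 2) ∧
        -- asymmetric cache complexity
        (∀ M B : ℕ, 1 ≤ B → τ * (B : ℝ) ^ d ≤ (M : ℝ) → τ * Real.log ω ≤ (M : ℝ) →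
          ω ^ ((d : ℝ) / ((d : ℝ) + 1)) * (M : ℝ) ^ (1 / (d : ℝ)) ≤ (n : ℝ) →
          ENNReal.ofReal (c * KDGrid.cacheBound d n ω M B)
              ≤ KDGrid.asymCacheComplexity M B ω
                  ((KDGrid.gridProg ω op g n).trace (KDGrid.stackBase d n)) ∧
            KDGrid.asymCacheComplexity M B ω
                  ((KDGrid.gridProg ω op g n).trace (KDGrid.stackBase d n))
              ≤ ENNReal.ofReal (C * KDGrid.cacheBound d n ω M B)) := by
  obtain ⟨e, rfl⟩ : ∃ e, d = e + 1 := ⟨d - 1, by omega⟩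
  have hδ := KDGrid.cacheScale_pos e
  set C₁ : ℝ := 3 + 3 * (((e + 1 : ℕ) : ℝ) + 1) * (3 * ((e + 1 : ℕ) : ℝ) + 6) with hC₁
  set C₂ : ℝ := (3 ^ (e + 3) * (e + 1) + 3 ^ (e + 2) * 78) / KDGrid.cacheScale e with hC₂
  have h₁ : 0 ≤ C₁ := by positivity
  have h₂ : 0 ≤ C₂ := by positivity
  -- The value 1/10 comes from the lower bound on writes; 6, `C₁` and `C₂` come from the work, the
  -- span and the cache bound.
  refine ⟨1 / 10, 6 + C₁ + C₂, (3 / KDGrid.cacheScale e) ^ (e + 1), by norm_num, by positivity,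
    by positivity, ?_⟩
  intro V op hop g n hn ω hω
  refine ⟨⟨KDGrid.computes_trace ω g hop hn,
    fun l hl => KDGrid.computes_of_isSchedule ω g hop hn hl⟩, ⟨?_, ?_⟩, fun hn2 => ?_, ?_⟩
  · have h := KDGrid.vol_le_work_asymAlg ω op g (KDGrid.inputAddr n) (fun _ => 0) (fun _ => n)
      (fun _ => hn) (KDGrid.outputAddr n) (KDGrid.stackBase (e + 1) n)
    have h' : (n : ℝ) ^ (e + 1 + 1)
        ≤ ((KDGrid.gridProg ω op g n).work (KDGrid.stackBase (e + 1) n) : ℝ) := by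
      have hv : KDGrid.vol (fun _ : Fin (e + 1 + 1) => n) = n ^ (e + 1 + 1) := by
        simp [KDGrid.vol]
      rw [hv] at h
      exact_mod_cast h
    have : (0 : ℝ) ≤ (n : ℝ) ^ (e + 1 + 1) := by positivity
    linarith
  · have h := KDGrid.work_asymAlg_le ω op g (KDGrid.inputAddr n) (fun _ => 0) (fun _ => n)
      (fun _ => hn) (KDGrid.outputAddr n) (KDGrid.stackBase (e + 1) n)
    have h' : ((KDGrid.gridProg ω op g n).work (KDGrid.stackBase (e + 1) n) : ℝ)
        ≤ 6 * (n : ℝ) ^ (e + 1 + 1) := by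
      have hv : KDGrid.vol (fun _ : Fin (e + 1 + 1) => n) = n ^ (e + 1 + 1) := by
        simp [KDGrid.vol]
      rw [hv] at h
      exact_mod_cast (Nat.le_add_right _ _).trans ((Nat.le_add_right _ _).trans h)
    refine h'.trans ?_
    gcongr
    linarith
  · refine (KDGrid.span_gridProg_le ω op g hn2 _).trans ?_
    exact mul_le_mul_of_nonneg_right (by linarith) (sq_nonneg _)
  · intro M B hB hMB hMω hnM
    have hM : 1 ≤ M := by
      have h1 : (0 : ℝ) < M := lt_of_lt_of_le (by positivity) hMB
      exact_mod_cast h1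
    refine ⟨KDGrid.cacheBound_le_asymCacheComplexity g hop hd hω hB hM hn, ?_⟩
    refine (KDGrid.asymCacheComplexity_le_cacheBound g hop hω hB hMB hMω hn hnM).trans
      (ENNReal.ofReal_le_ofReal ?_)
    have : 0 ≤ KDGrid.cacheBound (e + 1) n ω M B := by
      unfold KDGrid.cacheBound
      positivity
    gcongr
    linarith
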